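/- **Consistency of frequency marching for rank-one multi-reference factor analysis.** Let $L\ge 1$, let $\theta\in\mathbb C^L$ with $\|\theta\|_2=1$, let $\lambda>0$ and $\sigma\ge 0$. All indices of vectors in $\mathbb C^L$ are taken modulo $L$. Let $\mathcal R_s\{v\}[\ell]=v[\ell-s]$, let $F[\ell,k]=L^{-1/2}e^{-2\pi\imath \ell k/L}$ be the unitary DFT matrix, and write $\hat v=Fv$. Let $$y_i=\mathcal R_{s_i}\{a_i\theta\}+\eta_i,\qquad i=1,2,\dots,$$ where $a_i\sim\mathcal{CN}(0,\lambda)$ and $\eta_i\sim\mathcal{CN}(0,\sigma^2I_L)$ are circularly symmetric complex normal, $s_i$ is uniform on $\mathbb Z_L$, and all these variables are independent. Fix $c\in\mathbb R$ and let $\arg$ denote the argument with values in $(c,c+2\pi]$ (for $c=-\pi$, the principal argument). From $y_1,\dots,y_N$ and $\sigma^2$, the frequency-marching algorithm (MRFA-FM) computes $\tilde\theta=\tilde\theta_N$ as follows. 1. $\tilde p[k]=\frac1N\sum_{i=1}^N|\hat y_i[k]|^2-\sigma^2$ and $\tilde\lambda=\sum_{k}|\tilde p[k]|$. 2. $z_i[k]=\hat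 y_i[k]\,\overline{\hat y_i[k+1]}$ and $\tilde C=\frac1N\sum_{i=1}^N z_iz_i^*-\operatorname{diag}_k\big(\sigma^2(\tilde p[k]+\tilde p[k+1])\big)$. 3. $\tilde u$ is any unit eigenvector of the Hermitian matrix $\tilde C$ for its largest eigenvalue. 4. $\tilde u\leftarrow \tilde u\cdot\exp\{-\frac{\imath}{L}\sum_{k=0}^{L-1}\arg\tilde u[k]\}$; then $\tilde u\leftarrow\tilde u\cdot e^{2\pi\imath j_{\min}/L}$, where $j_{\min}\in\{0,\dots,L-1\}$ minimizes $\arg\big(\tilde u[0]e^{2\pi\imath j/L}\big)$ over $j$. 5. $\tilde\theta=F^*w$ with $w[k]=\sqrt{\max(\tilde p[k],0)/\tilde\lambda}\;\exp\{-\imath\sum_{\ell=0}^{k-1}\arg\tilde u[\ell]\}$ for $k=0,\dots,L-1$ (read as $w=0$ if $\tilde\lambda=0$). Assume $|\hat\theta[k]|>0$ for all $k=0,\dots,L-1$. Then there is a constant $\alpha\in\mathbb C$ with $|\alpha|=1$ such that: * (Consistency up to the inherent ambiguities.) Almost surely there are shifts $r_N\in\mathbb Z_L$ with $\lim_{N\to\infty}\|\theta-\alpha\,\mathcal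 R_{r_N}\{\tilde\theta_N\}\|_2=0$. * (Fixed shift.) If $\arg\big(\hat\theta[0]\overline{\hat\theta[1]}\big)\notin c+\frac{2\pi}{L}\mathbb Z$, then there is one fixed $r\in\mathbb Z_L$, depending neither on $N$ nor on the realization, such that $\lim_{N\to\infty}\|\theta-\alpha\,\mathcal R_r\{\tilde\theta_N\}\|_2=0$ almost surely. -/

import Mathlib

open MeasureTheory ProbabilityTheory Filter Topology
open scoped NNReal Matrix

noncomputable section

namespace MRFA

variable {L : ℕ} [NeZero L]

/-! Signals in `ℂ^L` are functions on `ZMod L`, so that all indices are periodic. -/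

/-- The Euclidean norm on `ℂ^L`. -/
def l2Norm (v : ZMod L → ℂ) : ℝ := ‖WithLp.toLp 2 v‖

/-- The cyclic shift `(R_s v)[ℓ] = v[ℓ - s]`. -/
def cyclicShift (s : ZMod L) (v : ZMod L → ℂ) : ZMod L → ℂ := fun l => v (l - s)

/-- The unitary discrete Fourier matrix `F[ℓ,k] = L^{-1/2} ω^{ℓk}`, `ω = e^{-2πi/L}`. -/
def dftMatrix (L : ℕ) [NeZero L] : Matrix (ZMod L) (ZMod L) ℂ := fun l k =>
  (1 / (Real.sqrt L : ℂ)) *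
    Complex.exp (-(2 * (Real.pi : ℂ) * Complex.I) / (L : ℂ)) ^ (l.val * k.val)

/-- The Fourier transform `v̂ = F v`. -/
def fourier (v : ZMod L → ℂ) : ZMod L → ℂ := dftMatrix L *ᵥ v

/-- The argument of a complex number with values in `(c, c + 2π]`.
For `c = -π` it is the principal argument. -/
def argFrom (c : ℝ) (z : ℂ) : ℝ := toIocMod Real.two_pi_pos c (Complex.arg z)

/-! ### The model -/

/-- The circularly symmetric complex normal law `CN(0, v)`: real and imaginary parts are
independent real normal variables of mean `0` and variance `v / 2`. -/
def circularNormal (v : ℝ≥0) : Measure ℂ :=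
  ((gaussianReal 0 (v / 2)).prod (gaussianReal 0 (v / 2))).map
    (fun p : ℝ × ℝ => (p.1 : ℂ) + (p.2 : ℂ) * Complex.I)

/-- The uniform law on `ZMod L`. -/
def uniformShift (L : ℕ) [NeZero L] : Measure (ZMod L) :=
  (PMF.uniformOfFintype (ZMod L)).toMeasure

/-- The law `CN(0, v I_L)` on `ℂ^L`. -/
def noiseLaw (L : ℕ) [NeZero L] (v : ℝ≥0) : Measure (ZMod L → ℂ) :=
  Measure.pi (fun _ => circularNormal v)

/-- `y 0, y 1, …` are independent observations of the rank-one model `y = R_s {a θ} + η`, with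
`a ∼ CN(0, lam)`, `s` uniform on `ZMod L` and `η ∼ CN(0, σ² I_L)` independent. -/
structure IsRankOneMRFA {Ω : Type*} [MeasurableSpace Ω] (P : Measure Ω)
    (θ : ZMod L → ℂ) (lam σ : ℝ≥0) (a : ℕ → Ω → ℂ) (s : ℕ → Ω → ZMod L)
    (η : ℕ → Ω → ZMod L → ℂ) (y : ℕ → Ω → ZMod L → ℂ) : Prop where
  measurable_a : ∀ i, Measurable (a i)
  measurable_s : ∀ i, Measurable (s i)
  measurable_noise : ∀ i, Measurable (η i)
  law : ∀ i, P.map (fun w => (a i w, s i w, η i w)) =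
    (circularNormal lam).prod ((uniformShift L).prod (noiseLaw L (σ ^ 2)))
  indep : iIndepFun (fun i w => (a i w, s i w, η i w)) P
  observation : ∀ i w, y i w = cyclicShift (s i w) (a i w • θ) + η i w

/-! ### Rank-one MRFA by frequency marching

Below `y : ℕ → ZMod L → ℂ` is the data, and only `y 0, …, y (N - 1)` are used. -/

/-- Power spectrum estimate `p̃[k] = N⁻¹ ∑ᵢ |ŷᵢ[k]|² - σ²`. -/
def powerEst (σ : ℝ≥0) (N : ℕ) (y : ℕ → ZMod L → ℂ) (k : ZMod L) : ℝ :=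
  (1 / (N : ℝ)) * ∑ i ∈ Finset.range N, ‖fourier (y i) k‖ ^ 2 - (σ : ℝ) ^ 2

/-- Estimate `λ̃ = ∑ₖ |p̃[k]|` of the signal strength. -/
def lamEst (σ : ℝ≥0) (N : ℕ) (y : ℕ → ZMod L → ℂ) : ℝ :=
  ∑ k, |powerEst σ N y k|

/-- Stride-one products `z[k] = ŷ[k] ŷ*[k+1]`. -/
def strideProd (v : ZMod L → ℂ) (k : ZMod L) : ℂ :=
  fourier v k * star (fourier v (k + 1))

/-- The bias-corrected sample covariance matrix of the stride-one products. -/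
def covEst (σ : ℝ≥0) (N : ℕ) (y : ℕ → ZMod L → ℂ) : Matrix (ZMod L) (ZMod L) ℂ :=
  (1 / (N : ℂ)) • ∑ i ∈ Finset.range N,
      Matrix.vecMulVec (strideProd (y i)) (star (strideProd (y i)))
    - Matrix.diagonal (fun k =>
        (((σ : ℝ) ^ 2 * (powerEst σ N y k + powerEst σ N y (k + 1)) : ℝ) : ℂ))

/-- `u` is a unit eigenvector of the (Hermitian) matrix `C` for its largest eigenvalue. -/
def IsLeadingEigenvector (C : Matrix (ZMod L) (ZMod L) ℂ) (u : ZMod L → ℂ) : Prop :=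
  l2Norm u = 1 ∧ ∃ ev : ℝ, C *ᵥ u = (ev : ℂ) • u ∧
    ∀ ev' : ℝ, Module.End.HasEigenvalue (Matrix.toLin' C) (ev' : ℂ) → ev' ≤ ev

/-- First phase correction: `u ← u · exp(-(i/L) ∑ₖ arg u[k])`. -/
def phaseCorrection (c : ℝ) (u : ZMod L → ℂ) : ZMod L → ℂ :=
  Complex.exp (-(Complex.I / (L : ℂ)) * ((∑ k, argFrom c (u k) : ℝ) : ℂ)) • u

/-- The unimodular number `e^{2πij/L}`. -/
def rootPhase (L j : ℕ) : ℂ :=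
  Complex.exp (2 * (Real.pi : ℂ) * Complex.I * (j : ℂ) / (L : ℂ))

/-- `j ∈ {0, …, L-1}` minimizes `arg (u[0] e^{2πij/L})`. -/
def IsMinimalPhaseIndex (c : ℝ) (u : ZMod L → ℂ) (j : ℕ) : Prop :=
  j < L ∧ ∀ j' < L, argFrom c (u 0 * rootPhase L j) ≤ argFrom c (u 0 * rootPhase L j')

/-- Magnitude estimate `√(p̃[k] / λ̃)`. -/
def magnitudeEst (σ : ℝ≥0) (N : ℕ) (y : ℕ → ZMod L → ℂ) (k : ZMod L) : ℝ :=
  Real.sqrt (powerEst σ N y k / lamEst σ N y)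

/-- Frequency marching: the phases `exp(-i ∑_{ℓ<k} arg u[ℓ])`, `k = 0, …, L-1`. -/
def frequencyMarching (c : ℝ) (u : ZMod L → ℂ) (k : ZMod L) : ℂ :=
  Complex.exp (-Complex.I * ((∑ l ∈ Finset.range k.val, argFrom c (u (l : ZMod L)) : ℝ) : ℂ))

/-- `est` is an output of the frequency marching algorithm on `y 0, …, y (N - 1)`; the algorithm is
free to use any normalized leading eigenvector `u`. -/
def IsFrequencyMarchingEstimate (c : ℝ) (σ : ℝ≥0) (N : ℕ) (y : ℕ → ZMod L → ℂ)
    (est : ZMod L → ℂ) : Prop :=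
  ∃ (u : ZMod L → ℂ) (j : ℕ), IsLeadingEigenvector (covEst σ N y) u ∧
    IsMinimalPhaseIndex c (phaseCorrection c u) j ∧
    est = (dftMatrix L)ᴴ *ᵥ (fun k =>
      frequencyMarching c (rootPhase L j • phaseCorrection c u) k * (magnitudeEst σ N y k : ℂ))

end MRFA

end

noncomputable section

namespace MRFA

/-! ### Moments of normal laws -/

/-! A cyclic shift multiplies all stride-one products by one common character value
(`strideProd_cyclicShift`), so `|ŷ[k]|²` and `z z*` do not see the shifts. Since the noise law is
shift invariant, the law of large numbers (`tendsto_average`) applies as if every observation were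
`a θ + η`. Wick's formula for circular normals then gives `p̃[k] → λ |θ̂[k]|²` and `C̃ → 2 λ² s s* +
d I`, where `s` is the stride-one product of `θ`: the diagonal correction removes all noise terms
that depend on `k`, and a multiple of the identity does not affect eigenvectors. By a Rayleigh
quotient comparison (`tendsto_aligned_eigenvector`), the leading eigenvector tends to `s / ‖s‖` up
to a phase.

The remaining question is that phase. The phases of `s` multiply to `1` around the cycle, so the
first phase correction forces the leftover global phase `ρ` to satisfy `ρ ^ L → 1`. Marching
telescopes the phases of `s` into those of `θ̂` relative to `θ̂[0]`, with an error `star ρ ^ k` at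
frequency `k`; for an `L`-th root of unity this error is exactly a shift. Hence consistency up to
shifts, with `α` the phase of `θ̂[0]`. The second correction places the first entry in an arc of
length `2π/L`, a fundamental domain for the roots of unity. If the limit is off its endpoints modulo
such roots, the root is eventually constant and deterministic (`exists_fixed_shift`). -/

lemma integral_sq_gaussianReal_zero (v : ℝ≥0) : ∫ x, x ^ 2 ∂gaussianReal 0 v = v := by
  have h := variance_eq_integral (μ := gaussianReal 0 v) (X := fun x => x)
    measurable_id'.aemeasurable
  rw [variance_fun_id_gaussianReal] at h
  simpa using h.symm

/-- Fourth derivative at `0` of the moment generating function `exp (v t² / 2)`. Every derivative is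
a polynomial times this exponential, and `hd` is the recursion `p ↦ p' + v t p`. -/
lemma integral_fourth_gaussianReal_zero (v : ℝ≥0) :
    ∫ x, x ^ 4 ∂gaussianReal 0 v = 3 * (v : ℝ) ^ 2 := by
  have h := iteratedDeriv_mgf_zero (X := fun x => x) (μ := gaussianReal 0 v) (by simp) 4
  have he : ∀ t : ℝ, HasDerivAt (fun t => Real.exp (v * t ^ 2 / 2))
      (v * t * Real.exp (v * t ^ 2 / 2)) t := by
    intro t
    refine ((((hasDerivAt_id' t).fun_pow 2).const_mul (v : ℝ)).div_const 2).exp.congr_deriv ?_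
    push_cast
    ring
  have hd : ∀ p q : ℝ → ℝ, (∀ t, HasDerivAt p (q t) t) →
      deriv (fun t => p t * Real.exp (v * t ^ 2 / 2)) =
        fun t => (q t + p t * (v * t)) * Real.exp (v * t ^ 2 / 2) := by
    intro p q hpq
    ext t
    rw [((hpq t).fun_mul (he t)).deriv]
    ring
  have h1 : deriv (fun t => Real.exp (v * t ^ 2 / 2)) =
      fun t => (v * t) * Real.exp (v * t ^ 2 / 2) := by
    ext t
    exact (he t).deriv
  have hv : ∀ t : ℝ, HasDerivAt (fun t : ℝ => (v : ℝ) * t) (v : ℝ) t := fun t =>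
    ((hasDerivAt_id' t).const_mul (v : ℝ)).congr_deriv (mul_one _)
  have hv2 : ∀ t : ℝ, HasDerivAt (fun t : ℝ => v + v * t * (v * t))
      (2 * v ^ 2 * t : ℝ) t := fun t =>
    (((hv t).fun_mul (hv t)).const_add (v : ℝ)).congr_deriv (by ring)
  have h2 := hd (fun t => v * t) (fun _ => v) hv
  have h3 := hd (fun t => v + v * t * (v * t)) (fun t => 2 * v ^ 2 * t) hv2
  have h4 := hd (fun t => 2 * v ^ 2 * t + (v + v * t * (v * t)) * (v * t))
    (fun t => 3 * v ^ 2 + 3 * v ^ 3 * t ^ 2) (fun t =>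
      (((hasDerivAt_id' t).const_mul (2 * (v : ℝ) ^ 2)).fun_add
        ((hv2 t).fun_mul (hv t))).congr_deriv (by ring))
  rw [mgf_fun_id_gaussianReal] at h
  simp only [zero_mul, zero_add, iteratedDeriv_succ, iteratedDeriv_zero, h1, h2, h3, h4] at h
  simpa using h.symm

instance (v : ℝ≥0) : IsProbabilityMeasure (circularNormal v) :=
  Measure.isProbabilityMeasure_map (by fun_prop)

lemma integral_circularNormal (v : ℝ≥0) {f : ℂ → ℂ} (hf : Continuous f) :
    ∫ z, f z ∂circularNormal v =
      ∫ p : ℝ × ℝ, f ((p.1 : ℂ) + (p.2 : ℂ) * Complex.I)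
        ∂(gaussianReal 0 (v / 2)).prod (gaussianReal 0 (v / 2)) :=
  integral_map (by fun_prop) hf.aestronglyMeasurable

/-- A quarter turn acts as `(x, y) ↦ (-y, x)`, a swap and a reflection of iid centred normals. It is
all the circular symmetry needed. -/
lemma measurePreserving_I_mul_circularNormal (v : ℝ≥0) :
    MeasurePreserving (fun z => Complex.I * z) (circularNormal v) (circularNormal v) := by
  refine ⟨by fun_prop, ?_⟩
  set g := gaussianReal 0 (v / 2)
  have hneg : MeasurePreserving (fun x : ℝ => -x) g g :=
    ⟨by fun_prop, by simp [g, gaussianReal_map_neg]⟩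
  have hrot : MeasurePreserving (fun p : ℝ × ℝ => (-p.2, p.1)) (g.prod g) (g.prod g) :=
    (hneg.prod (MeasurePreserving.id g)).comp Measure.measurePreserving_swap
  rw [circularNormal, Measure.map_map (by fun_prop) (by fun_prop)]
  conv_rhs => rw [← hrot.map_eq, Measure.map_map (by fun_prop) (by fun_prop)]
  congr 1
  ext p
  simp only [Function.comp_apply, Complex.ofReal_neg]
  linear_combination (p.2 : ℂ) * Complex.I_mul_I

/-- The quarter turn multiplies the integral by `i ^ (p - q)`, which differs from `1` because `0 <
|p - q| ≤ 2`. -/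
lemma integral_pow_mul_circularNormal_eq_zero (v : ℝ≥0) {p q : ℕ} (hp : p ≤ 2) (hq : q ≤ 2)
    (hpq : p ≠ q) : ∫ z, z ^ p * (star z) ^ q ∂circularNormal v = 0 := by
  have h := integral_map (μ := circularNormal v) (φ := fun z => Complex.I * z) (by fun_prop)
    (f := fun z => z ^ p * (star z) ^ q)
    (by exact Continuous.aestronglyMeasurable (by fun_prop))
  rw [(measurePreserving_I_mul_circularNormal v).map_eq] at h
  have h' : ∀ z : ℂ, (Complex.I * z) ^ p * (star (Complex.I * z)) ^ q =
      (Complex.I ^ p * (-Complex.I) ^ q) * (z ^ p * (star z) ^ q) := by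
    intro z
    simp only [star_mul', Complex.star_def, Complex.conj_I, mul_pow]
    ring
  simp only [h', integral_const_mul] at h
  have hne : Complex.I ^ p * (-Complex.I) ^ q ≠ 1 := by
    intro hh
    have hre := congrArg Complex.re hh
    interval_cases p <;> interval_cases q <;> first | omega | (norm_num [pow_succ] at hre)
  have : (1 - Complex.I ^ p * (-Complex.I) ^ q) *
      ∫ z, z ^ p * (star z) ^ q ∂circularNormal v = 0 := by
    linear_combination h
  exact (mul_eq_zero.1 this).resolve_left (sub_ne_zero.2 (Ne.symm hne))

lemma integrable_pow_gaussianReal (v : ℝ≥0) (n : ℕ) :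
    Integrable (fun x : ℝ => x ^ n) (gaussianReal 0 v) := by
  have h := (memLp_id_gaussianReal (μ := 0) (v := v) (n : ℝ≥0)).integrable_norm_pow'
  refine h.mono' (by fun_prop) (ae_of_all _ fun x => ?_)
  simp

lemma integral_mul_star_circularNormal (v : ℝ≥0) :
    ∫ z, z * star z ∂circularNormal v = (v : ℂ) := by
  rw [integral_circularNormal v (by fun_prop)]
  have h : ∀ p : ℝ × ℝ, ((p.1 : ℂ) + (p.2 : ℂ) * Complex.I) *
      star ((p.1 : ℂ) + (p.2 : ℂ) * Complex.I) = ((p.1 ^ 2 + p.2 ^ 2 : ℝ) : ℂ) := by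
    intro p
    rw [Complex.star_def, Complex.mul_conj, Complex.normSq_add_mul_I]
  have hi := integrable_pow_gaussianReal (v / 2) 2
  simp only [h]
  rw [integral_complex_ofReal, integral_add (hi.comp_fst _) (hi.comp_snd _),
    integral_fun_fst (f := fun x : ℝ => x ^ 2), integral_fun_snd (f := fun x : ℝ => x ^ 2),
    integral_sq_gaussianReal_zero]
  simp

lemma integral_sq_mul_star_sq_circularNormal (v : ℝ≥0) :
    ∫ z, z ^ 2 * (star z) ^ 2 ∂circularNormal v = 2 * (v : ℂ) ^ 2 := by
  rw [integral_circularNormal v (by fun_prop)]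
  have h : ∀ p : ℝ × ℝ, ((p.1 : ℂ) + (p.2 : ℂ) * Complex.I) ^ 2 *
      star ((p.1 : ℂ) + (p.2 : ℂ) * Complex.I) ^ 2 =
        (((p.1 ^ 4 + p.2 ^ 4) + 2 * (p.1 ^ 2 * p.2 ^ 2) : ℝ) : ℂ) := by
    intro p
    rw [← mul_pow, Complex.star_def, Complex.mul_conj, Complex.normSq_add_mul_I,
      ← Complex.ofReal_pow]
    congr 1
    ring
  have hi := integrable_pow_gaussianReal (v / 2) 4
  have hi2 := integrable_pow_gaussianReal (v / 2) 2
  simp only [h]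
  rw [integral_complex_ofReal, integral_add ((hi.comp_fst _).fun_add (hi.comp_snd _))
      ((hi2.mul_prod hi2).const_mul 2),
    integral_add (hi.comp_fst _) (hi.comp_snd _),
    integral_fun_fst (f := fun x : ℝ => x ^ 4), integral_fun_snd (f := fun x : ℝ => x ^ 4),
    integral_const_mul, integral_prod_mul (fun x : ℝ => x ^ 2) (fun x : ℝ => x ^ 2),
    integral_sq_gaussianReal_zero, integral_fourth_gaussianReal_zero]
  simp
  ring

lemma memLp_circularNormal (v : ℝ≥0) : MemLp (fun z => z) 4 (circularNormal v) := by
  have hr : ∀ v : ℝ≥0, MemLp (fun x : ℝ => (x : ℂ)) 4 (gaussianReal 0 v) := fun v =>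
    (memLp_id_gaussianReal' (μ := 0) (v := v) 4 (by simp)).ofReal
  refine (memLp_map_measure_iff (by fun_prop) (by fun_prop)).2 ?_
  have h1 := (hr (v / 2)).comp_fst (gaussianReal 0 (v / 2))
  have h2 := (hr (v / 2)).comp_snd (gaussianReal 0 (v / 2))
  exact h1.add (h2.mul_const Complex.I)

/-! ### Wick's formula for linear forms in independent circular normal variables -/

lemma integral_pow_mul_circularNormal (v : ℝ≥0) {p q : ℕ} (hp : p ≤ 2) (hq : q ≤ 2) :
    ∫ z, z ^ p * (star z) ^ q ∂circularNormal v =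
      if p = q then (p.factorial : ℂ) * (v : ℂ) ^ p else 0 := by
  split_ifs with h
  · subst h
    interval_cases p
    · simp
    · simpa using integral_mul_star_circularNormal v
    · simpa using integral_sq_mul_star_sq_circularNormal v
  · exact integral_pow_mul_circularNormal_eq_zero v hp hq h

section Wick

variable {ι : Type*} [Fintype ι]

/-- The coordinates of `(a, η)`, with `none` for `a`. -/
def jointCoord (t : Option ι) (p : ℂ × (ι → ℂ)) : ℂ := t.elim p.1 p.2

/-- The variances of the coordinates of `(a, η)`. -/
def jointVar (lam v : ℝ≥0) (t : Option ι) : ℝ≥0 := t.elim lam (fun _ => v)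

/-- The law of `(a, η)`. -/
def jointLaw (ι : Type*) [Fintype ι] (lam v : ℝ≥0) : Measure (ℂ × (ι → ℂ)) :=
  (circularNormal lam).prod (Measure.pi fun _ => circularNormal v)

instance (lam v : ℝ≥0) : IsProbabilityMeasure (jointLaw ι lam v) := by
  unfold jointLaw; infer_instance

/-- The linear form with coefficients `x`. -/
def linearForm (x : Option ι → ℂ) (p : ℂ × (ι → ℂ)) : ℂ := ∑ t, x t * jointCoord t p

lemma integral_prod_jointCoord (lam v : ℝ≥0) (g : Option ι → ℂ → ℂ) :
    ∫ p, ∏ t, g t (jointCoord t p) ∂jointLaw ι lam v =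
      ∏ t, ∫ z, g t z ∂circularNormal (jointVar lam v t) := by
  simp only [Fintype.prod_option, jointLaw, jointCoord, jointVar, Option.elim]
  rw [integral_prod_mul (g none) (fun x : ι → ℂ => ∏ i, g (some i) (x i)),
    integral_fintype_prod_eq_prod (fun i => g (some i))]

lemma memLp_jointCoord (lam v : ℝ≥0) (t : Option ι) :
    MemLp (jointCoord t) 4 (jointLaw ι lam v) := by
  cases t with
  | none => exact (memLp_circularNormal lam).comp_fst _
  | some i =>
    have h : MemLp (fun x : ι → ℂ => x i) 4 (Measure.pi fun _ : ι => circularNormal v) :=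
      (memLp_circularNormal v).comp_measurePreserving
        (measurePreserving_eval (fun _ : ι => circularNormal v) i)
    exact h.comp_snd _

lemma memLp_linearForm (lam v : ℝ≥0) (x : Option ι → ℂ) :
    MemLp (linearForm x) 4 (jointLaw ι lam v) :=
  memLp_finsetSum _ fun t _ => (memLp_jointCoord lam v t).const_mul (x t)

/-- Domination by the sum of the fourth powers, through the inequality of arithmetic and geometric
means. -/
lemma integrable_mul_star_mul_star_mul {α : Type*} {m : MeasurableSpace α} {μ : Measure α}
    {A B C D : α → ℂ} (hA : MemLp A 4 μ) (hB : MemLp B 4 μ) (hC : MemLp C 4 μ)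
    (hD : MemLp D 4 μ) :
    Integrable (fun x => A x * star (B x) * star (C x) * D x) μ := by
  have h : ∀ {f : α → ℂ}, MemLp f 4 μ → Integrable (fun x => ‖f x‖ ^ 4) μ := fun hf =>
    MemLp.integrable_norm_pow (p := 4) (by exact_mod_cast hf) (by norm_num)
  refine ((((h hA).fun_add (h hB)).fun_add (h hC)).fun_add (h hD)).mono' ?_
    (ae_of_all _ fun x => ?_)
  · exact ((hA.1.mul hB.1.star).mul hC.1.star).mul hD.1
  · simp only [norm_mul, norm_star]
    set a := ‖A x‖
    set b := ‖B x‖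
    set c := ‖C x‖
    set d := ‖D x‖
    nlinarith [sq_nonneg (a * b - c * d), sq_nonneg (a ^ 2 - b ^ 2), sq_nonneg (c ^ 2 - d ^ 2),
      sq_nonneg (a ^ 2), sq_nonneg (b ^ 2), sq_nonneg (c ^ 2), sq_nonneg (d ^ 2)]

lemma integrable_mul_star {α : Type*} {m : MeasurableSpace α} {μ : Measure α}
    [IsProbabilityMeasure μ] {A B : α → ℂ} (hA : MemLp A 4 μ) (hB : MemLp B 4 μ) :
    Integrable (fun x => A x * star (B x)) μ := by
  have h1 : MemLp (fun _ : α => (1 : ℂ)) 4 μ := memLp_const 1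
  simpa using integrable_mul_star_mul_star_mul hA hB h1 h1

variable [DecidableEq ι]

lemma integral_jointCoord_second (lam v : ℝ≥0) (i j : Option ι) :
    ∫ p, jointCoord i p * star (jointCoord j p) ∂jointLaw ι lam v =
      if i = j then (jointVar lam v i : ℂ) else 0 := by
  have h := integral_prod_jointCoord lam v
    (fun t z => z ^ (if i = t then 1 else 0) * (star z) ^ (if j = t then 1 else 0))
  simp only [Finset.prod_mul_distrib, Finset.prod_pow_boole, Finset.mem_univ, if_true] at h
  rw [h]
  have hM : ∀ t : Option ι, ∫ z, z ^ (if i = t then 1 else 0) * (star z) ^ (if j = t then 1 else 0)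
      ∂circularNormal (jointVar lam v t) = _ := fun t => integral_pow_mul_circularNormal _
        (by split_ifs <;> omega) (by split_ifs <;> omega)
  simp only [hM]
  split_ifs with hij
  · subst hij
    rw [Fintype.prod_eq_single i (fun t ht => by simp [ht.symm])]
    simp
  · exact Finset.prod_eq_zero (Finset.mem_univ i) (by simp [Ne.symm hij])

/-- By independence the moment factors over the coordinates `t`, with exponents counting how often
`t` occurs plainly and conjugated. Only `{i, n} = {j, m}` as multisets survives. -/
lemma integral_jointCoord_fourth (lam v : ℝ≥0) (i j m n : Option ι) :
    ∫ p, jointCoord i p * star (jointCoord j p) * star (jointCoord m p) * jointCoord n p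
        ∂jointLaw ι lam v =
      (if i = j then (jointVar lam v i : ℂ) else 0) * (if n = m then (jointVar lam v n : ℂ) else 0)
      + (if i = m then (jointVar lam v i : ℂ) else 0) *
        (if n = j then (jointVar lam v n : ℂ) else 0) := by
  have h := integral_prod_jointCoord lam v
    (fun t z => z ^ ((if i = t then 1 else 0) + (if n = t then 1 else 0)) *
      (star z) ^ ((if j = t then 1 else 0) + (if m = t then 1 else 0)))
  have hM : ∀ t : Option ι, ∫ z, z ^ ((if i = t then 1 else 0) + (if n = t then 1 else 0)) *
      (star z) ^ ((if j = t then 1 else 0) + (if m = t then 1 else 0))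
      ∂circularNormal (jointVar lam v t) = _ := fun t => integral_pow_mul_circularNormal _
        (by split_ifs <;> omega) (by split_ifs <;> omega)
  simp only [hM] at h
  simp only [pow_add, Finset.prod_mul_distrib, Finset.prod_pow_boole, Finset.mem_univ,
    if_true] at h
  have hcomm : ∀ p : ℂ × (ι → ℂ), jointCoord i p * star (jointCoord j p) *
      star (jointCoord m p) * jointCoord n p =
      jointCoord i p * jointCoord n p * (star (jointCoord j p) * star (jointCoord m p)) :=
    fun p => by ring
  simp only [hcomm, h]
  -- One unbalanced coordinate annihilates the whole product.
  have hzero : ∀ t : Option ι, ((if i = t then 1 else 0) + (if n = t then 1 else 0) : ℕ) ≠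
      (if j = t then 1 else 0) + (if m = t then 1 else 0) →
      (∏ t : Option ι, if ((if i = t then 1 else 0) + (if n = t then 1 else 0) : ℕ) =
        (if j = t then 1 else 0) + (if m = t then 1 else 0) then
        ((((if i = t then 1 else 0) + (if n = t then 1 else 0) : ℕ).factorial : ℂ)) *
        ((jointVar lam v t : ℂ) ^ (if i = t then 1 else 0) *
          (jointVar lam v t : ℂ) ^ (if n = t then 1 else 0)) else 0) = 0 := fun t ht =>
    Finset.prod_eq_zero (Finset.mem_univ t) (if_neg ht)
  by_cases hin : i = n
  · subst hin
    by_cases hj : i = j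
    · subst hj
      by_cases hm : i = m
      · subst hm
        -- All four indices agree: the factor `2!` accounts for the two coinciding pairings.
        rw [Fintype.prod_eq_single i (fun t ht => by simp [ht.symm])]
        simp
        ring
      · rw [hzero i (by simp [Ne.symm hm])]
        simp [hm]
    · rw [hzero i (by simp only [if_true, Ne.symm hj, if_false]; split_ifs <;> omega)]
      simp [hj]
  · have key : ∀ j m : Option ι, i = j → n = m →
        (∏ t : Option ι, if ((if i = t then 1 else 0) + (if n = t then 1 else 0) : ℕ) =
        (if j = t then 1 else 0) + (if m = t then 1 else 0) then
        ((((if i = t then 1 else 0) + (if n = t then 1 else 0) : ℕ).factorial : ℂ)) *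
        ((jointVar lam v t : ℂ) ^ (if i = t then 1 else 0) *
          (jointVar lam v t : ℂ) ^ (if n = t then 1 else 0)) else 0) =
        jointVar lam v i * jointVar lam v n := by
      rintro j m rfl rfl
      rw [Fintype.prod_eq_mul i n hin (fun t ht => by simp [ht.1.symm, ht.2.symm])]
      simp [hin, Ne.symm hin]
    by_cases hj : i = j
    · by_cases hm : n = m
      · rw [key j m hj hm]
        subst hj hm
        simp [hin]
      · rw [hzero n (by subst hj; simp [Ne.symm hm, hin])]
        subst hj
        simp [hm, Ne.symm hin]
    · by_cases hm : i = m
      · by_cases hn : n = j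
        · have := key m j hm hn
          simp only [add_comm (if m = _ then 1 else 0)] at this
          rw [this]
          subst hm hn
          simp [hin]
        · rw [hzero n (by subst hm; simp [Ne.symm hn, hin])]
          simp [hj, hn]
      · rw [hzero i (by simp [Ne.symm hj, Ne.symm hm])]
        simp [hj, hm]

/-- The covariance of two linear forms. -/
def formCov (lam v : ℝ≥0) (x y : Option ι → ℂ) : ℂ :=
  ∑ t, x t * star (y t) * (jointVar lam v t : ℂ)

lemma integral_linearForm_mul_star (lam v : ℝ≥0) (x y : Option ι → ℂ) :
    ∫ p, linearForm x p * star (linearForm y p) ∂jointLaw ι lam v = formCov lam v x y := by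
  have h : ∀ p : ℂ × (ι → ℂ), linearForm x p * star (linearForm y p) =
      ∑ i, ∑ j, (x i * star (y j)) * (jointCoord i p * star (jointCoord j p)) := by
    intro p
    simp only [linearForm, star_sum, star_mul', Finset.sum_mul_sum]
    refine Finset.sum_congr rfl fun i _ => Finset.sum_congr rfl fun j _ => by ring
  have hi : ∀ i j : Option ι, Integrable
      (fun p => (x i * star (y j)) * (jointCoord i p * star (jointCoord j p)))
      (jointLaw ι lam v) := fun i j =>
    (integrable_mul_star (memLp_jointCoord lam v i) (memLp_jointCoord lam v j)).const_mul _
  simp only [h]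
  rw [integral_finsetSum _ fun i _ => integrable_finsetSum _ fun j _ => hi i j]
  refine Finset.sum_congr rfl fun i _ => ?_
  rw [integral_finsetSum _ fun j _ => hi i j]
  simp only [integral_const_mul, integral_jointCoord_second]
  simp

/-- Multilinear expansion. There are only two pairings because a plain factor can pair only with a
conjugated one. -/
lemma integral_linearForm_fourth (lam v : ℝ≥0) (x y z w : Option ι → ℂ) :
    ∫ p, linearForm x p * star (linearForm y p) * star (linearForm z p) * linearForm w p
        ∂jointLaw ι lam v =
      formCov lam v x y * formCov lam v w z + formCov lam v x z * formCov lam v w y := by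
  have h : ∀ p : ℂ × (ι → ℂ),
      linearForm x p * star (linearForm y p) * star (linearForm z p) * linearForm w p =
      ∑ i, ∑ j, ∑ m, ∑ n, (x i * star (y j) * star (z m) * w n) *
        (jointCoord i p * star (jointCoord j p) * star (jointCoord m p) * jointCoord n p) := by
    intro p
    have h4 : ∀ a b c d : Option ι → ℂ, (∑ i, a i) * (∑ j, b j) * (∑ m, c m) * (∑ n, d n) =
        ∑ i, ∑ j, ∑ m, ∑ n, a i * b j * c m * d n := fun a b c d => by
      simp only [← Finset.mul_sum, ← Finset.sum_mul]
    simp only [linearForm, star_sum, star_mul', h4]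
    refine Finset.sum_congr rfl fun i _ => Finset.sum_congr rfl fun j _ =>
      Finset.sum_congr rfl fun m _ => Finset.sum_congr rfl fun n _ => by ring
  have hi : ∀ i j m n : Option ι, Integrable
      (fun p => (x i * star (y j) * star (z m) * w n) *
        (jointCoord i p * star (jointCoord j p) * star (jointCoord m p) * jointCoord n p))
      (jointLaw ι lam v) := fun i j m n =>
    (integrable_mul_star_mul_star_mul (memLp_jointCoord lam v i) (memLp_jointCoord lam v j)
      (memLp_jointCoord lam v m) (memLp_jointCoord lam v n)).const_mul _
  simp only [h]
  rw [integral_finsetSum _ fun i _ => integrable_finsetSum _ fun j _ =>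
    integrable_finsetSum _ fun m _ => integrable_finsetSum _ fun n _ => hi i j m n]
  have hsum : ∀ i : Option ι, ∫ p, ∑ j, ∑ m, ∑ n, (x i * star (y j) * star (z m) * w n) *
        (jointCoord i p * star (jointCoord j p) * star (jointCoord m p) * jointCoord n p)
        ∂jointLaw ι lam v =
      ∑ j, ∑ m, ∑ n, (x i * star (y j) * star (z m) * w n) *
        ((if i = j then (jointVar lam v i : ℂ) else 0) *
            (if n = m then (jointVar lam v n : ℂ) else 0)
          + (if i = m then (jointVar lam v i : ℂ) else 0) *
            (if n = j then (jointVar lam v n : ℂ) else 0)) := by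
    intro i
    rw [integral_finsetSum _ fun j _ => integrable_finsetSum _ fun m _ =>
      integrable_finsetSum _ fun n _ => hi i j m n]
    refine Finset.sum_congr rfl fun j _ => ?_
    rw [integral_finsetSum _ fun m _ => integrable_finsetSum _ fun n _ => hi i j m n]
    refine Finset.sum_congr rfl fun m _ => ?_
    rw [integral_finsetSum _ fun n _ => hi i j m n]
    refine Finset.sum_congr rfl fun n _ => ?_
    rw [integral_const_mul, integral_jointCoord_fourth]
  have hcov : ∀ x y : Option ι → ℂ, formCov lam v x y =
      ∑ i, ∑ j, x i * star (y j) * (if i = j then (jointVar lam v i : ℂ) else 0) := fun x y => by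
    simp [formCov]
  simp only [hsum, mul_add, Finset.sum_add_distrib, hcov]
  congr 1
  · rw [Finset.sum_comm (f := fun n m => w n * star (z m) * _)]
    simp only [Finset.sum_mul]
    simp only [Finset.mul_sum]
    refine Finset.sum_congr rfl fun i _ => Finset.sum_congr rfl fun j _ =>
      Finset.sum_congr rfl fun m _ => Finset.sum_congr rfl fun n _ => by ring
  · rw [Finset.sum_comm (f := fun n j => w n * star (y j) * _)]
    simp only [Finset.sum_mul]
    simp only [Finset.mul_sum]
    refine Finset.sum_congr rfl fun i _ => ?_
    rw [Finset.sum_comm]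
    refine Finset.sum_congr rfl fun m _ =>
      Finset.sum_congr rfl fun j _ => Finset.sum_congr rfl fun n _ => by ring

end Wick

/-! ### The discrete Fourier transform -/

section Fourier

variable {L : ℕ} [NeZero L]

lemma stdAddChar_natCast (j : ℕ) : ZMod.stdAddChar (j : ZMod L) = rootPhase L j := by
  have := ZMod.stdAddChar_coe (N := L) (j : ℤ)
  simpa [rootPhase] using this

lemma norm_stdAddChar (x : ZMod L) : ‖ZMod.stdAddChar x‖ = 1 := by
  rw [ZMod.stdAddChar_apply]
  exact Circle.norm_coe _

lemma star_stdAddChar (x : ZMod L) : star (ZMod.stdAddChar x) = ZMod.stdAddChar (-x) := by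
  rw [Complex.star_def, AddChar.map_neg_eq_inv, ← Complex.inv_eq_conj (norm_stdAddChar x)]

/-- Replaces exponents in `ℕ` by an additive character of `ZMod L`, so that periodic index
arithmetic becomes ring arithmetic. -/
lemma dftMatrix_apply (l k : ZMod L) :
    dftMatrix L l k = (1 / (Real.sqrt L : ℂ)) * ZMod.stdAddChar (-(l * k)) := by
  unfold dftMatrix
  congr 1
  have h : -(l * k) = (((-((l.val * k.val : ℕ) : ℤ)) : ℤ) : ZMod L) := by simp
  rw [h, ZMod.stdAddChar_coe, ← Complex.exp_nat_mul]
  congr 1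
  push_cast
  ring

lemma star_dftMatrix_apply (l k : ZMod L) :
    star (dftMatrix L l k) = (1 / (Real.sqrt L : ℂ)) * ZMod.stdAddChar (l * k) := by
  rw [dftMatrix_apply, star_mul', star_stdAddChar, neg_neg]
  simp

lemma sum_dftMatrix_mul_star (k l : ZMod L) :
    ∑ m, dftMatrix L k m * star (dftMatrix L l m) = if k = l then 1 else 0 := by
  have hL : (L : ℂ) ≠ 0 := Nat.cast_ne_zero.2 (NeZero.ne L)
  have hs : (Real.sqrt L : ℂ) * (Real.sqrt L : ℂ) = L := by
    rw [← Complex.ofReal_mul, Real.mul_self_sqrt (Nat.cast_nonneg L), Complex.ofReal_natCast]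
  have h : ∀ m : ZMod L, dftMatrix L k m * star (dftMatrix L l m) =
      (1 / (L : ℂ)) * ZMod.stdAddChar (m * (l - k)) := by
    intro m
    rw [dftMatrix_apply, star_dftMatrix_apply]
    have : m * (l - k) = -(k * m) + l * m := by ring
    rw [this, AddChar.map_add_eq_mul, ← hs]
    field_simp
  simp only [h]
  rw [← Finset.mul_sum, AddChar.sum_mulShift _ (ZMod.isPrimitive_stdAddChar L), ZMod.card]
  simp only [sub_eq_zero, eq_comm (a := l)]
  split_ifs <;> simp [hL]

lemma dftMatrix_mul_conjTranspose : dftMatrix L * (dftMatrix L)ᴴ = 1 := by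
  ext k l
  rw [Matrix.mul_apply, Matrix.one_apply, ← sum_dftMatrix_mul_star]
  rfl

lemma conjTranspose_mul_dftMatrix : (dftMatrix L)ᴴ * dftMatrix L = 1 :=
  mul_eq_one_comm.1 dftMatrix_mul_conjTranspose

lemma conjTranspose_mulVec_fourier (v : ZMod L → ℂ) : (dftMatrix L)ᴴ *ᵥ fourier v = v := by
  rw [fourier, Matrix.mulVec_mulVec, conjTranspose_mul_dftMatrix, Matrix.one_mulVec]

lemma fourier_cyclicShift (s : ZMod L) (v : ZMod L → ℂ) (k : ZMod L) :
    fourier (cyclicShift s v) k = ZMod.stdAddChar (-(k * s)) * fourier v k := by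
  simp only [fourier, Matrix.mulVec, dotProduct, cyclicShift, Finset.mul_sum]
  refine Fintype.sum_equiv (Equiv.subRight s) _ _ fun m => ?_
  simp only [dftMatrix_apply, Equiv.subRight_apply]
  have : -(k * m) = -(k * s) + -(k * (m - s)) := by ring
  rw [this, AddChar.map_add_eq_mul]
  ring

lemma cyclicShift_conjTranspose_mulVec (r : ZMod L) (w : ZMod L → ℂ) :
    cyclicShift r ((dftMatrix L)ᴴ *ᵥ w) =
      (dftMatrix L)ᴴ *ᵥ fun k => ZMod.stdAddChar (-(k * r)) * w k := by
  ext l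
  simp only [cyclicShift, Matrix.mulVec, dotProduct, Matrix.conjTranspose_apply,
    star_dftMatrix_apply]
  refine Finset.sum_congr rfl fun k _ => ?_
  have : k * (l - r) = k * l + -(k * r) := by ring
  rw [this, AddChar.map_add_eq_mul]
  ring

lemma l2Norm_sq (v : ZMod L → ℂ) : l2Norm v ^ 2 = ∑ k, ‖v k‖ ^ 2 := by
  rw [l2Norm, EuclideanSpace.norm_sq_eq]

lemma sum_mul_star_eq_l2Norm_sq (v : ZMod L → ℂ) : ∑ k, v k * star (v k) = (l2Norm v ^ 2 : ℝ) := by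
  rw [l2Norm_sq, Complex.ofReal_sum]
  refine Finset.sum_congr rfl fun k _ => ?_
  rw [Complex.star_def, Complex.mul_conj, Complex.normSq_eq_norm_sq]

lemma l2Norm_fourier (v : ZMod L → ℂ) : l2Norm (fourier v) = l2Norm v := by
  have h : fourier v ⬝ᵥ star (fourier v) = v ⬝ᵥ star v := by
    conv_rhs => rw [← conjTranspose_mulVec_fourier v]
    rw [Matrix.star_mulVec, Matrix.conjTranspose_conjTranspose, dotProduct_comm,
      dotProduct_comm (_ *ᵥ _), ← Matrix.dotProduct_mulVec, Matrix.mulVec_mulVec,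
      dftMatrix_mul_conjTranspose, Matrix.one_mulVec]
  have h2 : ((l2Norm (fourier v) ^ 2 : ℝ) : ℂ) = (l2Norm v ^ 2 : ℝ) := by
    rw [← sum_mul_star_eq_l2Norm_sq, ← sum_mul_star_eq_l2Norm_sq]
    exact h
  exact (pow_left_inj₀ (norm_nonneg _) (norm_nonneg _) two_ne_zero).1 (Complex.ofReal_injective h2)

/-- The frequency `k` cancels between `-k s` and `(k + 1) s`, leaving a scalar common to all
entries. -/
lemma strideProd_cyclicShift (s : ZMod L) (v : ZMod L → ℂ) (k : ZMod L) :
    strideProd (cyclicShift s v) k = ZMod.stdAddChar s * strideProd v k := by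
  simp only [strideProd, fourier_cyclicShift, star_mul', star_stdAddChar]
  have : s = -(k * s) + -(-((k + 1) * s)) := by ring
  conv_rhs => rw [this, AddChar.map_add_eq_mul]
  ring

lemma norm_fourier_cyclicShift (s : ZMod L) (v : ZMod L → ℂ) (k : ZMod L) :
    ‖fourier (cyclicShift s v) k‖ = ‖fourier v k‖ := by
  rw [fourier_cyclicShift, norm_mul, norm_stdAddChar, one_mul]

lemma strideProd_mul_star_cyclicShift (s : ZMod L) (v : ZMod L → ℂ) (k l : ZMod L) :
    strideProd (cyclicShift s v) k * star (strideProd (cyclicShift s v) l) =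
      strideProd v k * star (strideProd v l) := by
  rw [strideProd_cyclicShift, strideProd_cyclicShift, star_mul']
  have h : ZMod.stdAddChar s * star (ZMod.stdAddChar s) = (1 : ℂ) := by
    rw [star_stdAddChar, ← AddChar.map_add_eq_mul, add_neg_cancel, AddChar.map_zero_eq_one]
  linear_combination (strideProd v k * star (strideProd v l)) * h

lemma continuous_fourier : Continuous (fourier : (ZMod L → ℂ) → ZMod L → ℂ) :=
  Continuous.matrix_mulVec continuous_const continuous_id

end Fourier

/-! ### Laws of large numbers for shift invariant statistics -/

section Sampling

variable {L : ℕ} [NeZero L]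

lemma measurable_uncurry_cyclicShift :
    Measurable (fun p : ZMod L × (ZMod L → ℂ) => cyclicShift p.1 p.2) :=
  measurable_from_prod_countable_right fun s => measurable_pi_lambda _ fun l =>
    measurable_pi_apply (l - s)

lemma measurePreserving_cyclicShift_noiseLaw (s : ZMod L) (v : ℝ≥0) :
    MeasurePreserving (cyclicShift s) (noiseLaw L v) (noiseLaw L v) := by
  have h : cyclicShift s = MeasurableEquiv.piCongrLeft (fun _ => ℂ) (Equiv.addRight s) := by
    ext x l
    obtain ⟨l, rfl⟩ := (Equiv.addRight s).surjective l
    rw [MeasurableEquiv.coe_piCongrLeft, Equiv.piCongrLeft_apply_apply]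
    simp [cyclicShift]
  rw [h]
  exact measurePreserving_piCongrLeft (fun _ : ZMod L => circularNormal v) (Equiv.addRight s)

instance (v : ℝ≥0) : IsProbabilityMeasure (noiseLaw L v) := by
  unfold noiseLaw; infer_instance

instance : IsProbabilityMeasure (uniformShift L) := by
  unfold uniformShift; infer_instance

variable {Ω : Type*} [MeasurableSpace Ω] {P : Measure Ω}
  {θ : ZMod L → ℂ} {lam σ : ℝ≥0} {a : ℕ → Ω → ℂ} {s : ℕ → Ω → ZMod L}
  {η : ℕ → Ω → ZMod L → ℂ} {y : ℕ → Ω → ZMod L → ℂ}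

namespace IsRankOneMRFA

/-- Undoing a shift independent of the noise preserves the noise law conditionally on each value of
the shift; the skew product expresses this, after which the shift is forgotten. -/
lemma measurePreserving_alignedNoise (h : IsRankOneMRFA P θ lam σ a s η y) (i : ℕ) :
    MeasurePreserving (fun w => (a i w, cyclicShift (-(s i w)) (η i w))) P
      (jointLaw (ZMod L) lam (σ ^ 2)) := by
  have h0 : MeasurePreserving (fun w => (a i w, s i w, η i w)) P
      ((circularNormal lam).prod ((uniformShift L).prod (noiseLaw L (σ ^ 2)))) :=
    ⟨(h.measurable_a i).prodMk ((h.measurable_s i).prodMk (h.measurable_noise i)), h.law i⟩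
  have hm : Measurable (Function.uncurry fun (t : ZMod L) (v : ZMod L → ℂ) =>
      cyclicShift (-t) v) :=
    measurable_from_prod_countable_right fun t =>
      -- The variance `0` is a dummy: only measurability is used.
      (measurePreserving_cyclicShift_noiseLaw (-t) 0).measurable
  have h1 := (MeasurePreserving.id (uniformShift L)).skew_product (μc := noiseLaw L (σ ^ 2)) hm
    (ae_of_all _ fun t => (measurePreserving_cyclicShift_noiseLaw (-t) (σ ^ 2)).map_eq)
  have h2 := (MeasurePreserving.id (circularNormal lam)).prod (measurePreserving_snd.comp h1)
  exact h2.comp h0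

lemma observation_eq_cyclicShift (h : IsRankOneMRFA P θ lam σ a s η y) (i : ℕ) (w : Ω) :
    y i w = cyclicShift (s i w) (a i w • θ + cyclicShift (-(s i w)) (η i w)) := by
  rw [h.observation]
  ext l
  simp [cyclicShift]

lemma tendsto_average [IsProbabilityMeasure P] (h : IsRankOneMRFA P θ lam σ a s η y)
    {f : (ZMod L → ℂ) → ℂ}
    (hf : Continuous f) (hinv : ∀ t v, f (cyclicShift t v) = f v)
    (hint : Integrable (fun p : ℂ × (ZMod L → ℂ) => f (p.1 • θ + p.2))
      (jointLaw (ZMod L) lam (σ ^ 2))) :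
    ∀ᵐ w ∂P, Tendsto (fun N : ℕ => (1 / (N : ℂ)) * ∑ i ∈ Finset.range N, f (y i w)) atTop
      (𝓝 (∫ p, f (p.1 • θ + p.2) ∂jointLaw (ZMod L) lam (σ ^ 2))) := by
  -- Independence and equality of laws are read off the triples `(a, s, η)` through `G`; the mean is
  -- computed from the aligned pair.
  set G : ℂ × ZMod L × (ZMod L → ℂ) → ℂ := fun p => f (cyclicShift p.2.1 (p.1 • θ) + p.2.2)
  have hG : Measurable G := by
    refine hf.measurable.comp (Measurable.add ?_ (by fun_prop))
    exact measurable_uncurry_cyclicShift.comp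
      (Measurable.prodMk (by fun_prop)
        (by fun_prop : Measurable fun p : ℂ × ZMod L × (ZMod L → ℂ) => p.1 • θ))
  have hX : ∀ i, Measurable (fun w => (a i w, s i w, η i w)) := fun i =>
    (h.measurable_a i).prodMk ((h.measurable_s i).prodMk (h.measurable_noise i))
  have hXG : ∀ i, G ∘ (fun w => (a i w, s i w, η i w)) = fun w => f (y i w) := by
    intro i
    ext w
    simp only [Function.comp_apply, G, h.observation]
  have heq : ∀ i, (fun w => f (y i w)) =
      (fun p : ℂ × (ZMod L → ℂ) => f (p.1 • θ + p.2)) ∘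
        fun w => (a i w, cyclicShift (-(s i w)) (η i w)) := by
    intro i
    ext w
    rw [h.observation_eq_cyclicShift, hinv]
    rfl
  have hmp := h.measurePreserving_alignedNoise 0
  have hasm : AEStronglyMeasurable (fun p : ℂ × (ZMod L → ℂ) => f (p.1 • θ + p.2))
      (jointLaw (ZMod L) lam (σ ^ 2)) := hint.aestronglyMeasurable
  have hlln := strong_law_ae (μ := P) (fun i w => f (y i w)) ?_ ?_ ?_
  · have hval : ∫ w, f (y 0 w) ∂P =
        ∫ p, f (p.1 • θ + p.2) ∂jointLaw (ZMod L) lam (σ ^ 2) := by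
      rw [heq 0, ← hmp.map_eq, integral_map hmp.aemeasurable (by rwa [hmp.map_eq])]
      rfl
    rw [hval] at hlln
    filter_upwards [hlln] with w hw
    refine hw.congr fun N => ?_
    rw [Complex.real_smul]
    simp
  · rw [heq 0]
    exact (hmp.integrable_comp hasm).2 hint
  · intro i j hij
    have := (h.indep.comp (fun _ => G) (fun _ => hG)).indepFun hij
    simpa only [hXG] using this
  · intro i
    have hid : IdentDistrib (fun w => (a i w, s i w, η i w)) (fun w => (a 0 w, s 0 w, η 0 w)) P P :=
      ⟨(hX i).aemeasurable, (hX 0).aemeasurable, by rw [h.law i, h.law 0]⟩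
    have := hid.comp hG
    simpa only [hXG] using this

end IsRankOneMRFA

/-! ### The population moments -/

/-- The coefficients of the `k`-th Fourier coefficient of `a θ + η` as a linear form in `(a, η)`. -/
def fourierForm (θ : ZMod L → ℂ) (k : ZMod L) (t : Option (ZMod L)) : ℂ :=
  t.elim (fourier θ k) (dftMatrix L k)

lemma fourier_smul_add (θ : ZMod L → ℂ) (p : ℂ × (ZMod L → ℂ)) (k : ZMod L) :
    fourier (p.1 • θ + p.2) k = linearForm (fourierForm θ k) p := by
  simp only [linearForm, Fintype.sum_option, fourierForm, jointCoord, Option.elim, fourier,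
    Matrix.mulVec_add, Matrix.mulVec_smul, Pi.add_apply, Pi.smul_apply, smul_eq_mul]
  rw [mul_comm]
  rfl

lemma formCov_fourierForm (θ : ZMod L → ℂ) (lam v : ℝ≥0) (k l : ZMod L) :
    formCov lam v (fourierForm θ k) (fourierForm θ l) =
      lam * (fourier θ k * star (fourier θ l)) + if k = l then (v : ℂ) else 0 := by
  simp only [formCov, Fintype.sum_option, fourierForm, jointVar, Option.elim]
  rw [← Finset.sum_mul, sum_dftMatrix_mul_star]
  split_ifs <;> ring

lemma IsRankOneMRFA.tendsto_powerEst [IsProbabilityMeasure P]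
    (h : IsRankOneMRFA P θ lam σ a s η y) (k : ZMod L) :
    ∀ᵐ w ∂P, Tendsto (fun N => powerEst σ N (fun i => y i w) k) atTop
      (𝓝 (lam * ‖fourier θ k‖ ^ 2)) := by
  have hc : Continuous fun v : ZMod L → ℂ => fourier v k :=
    (continuous_apply k).comp continuous_fourier
  have hsq : ∀ z : ℂ, ((‖z‖ ^ 2 : ℝ) : ℂ) = z * star z := fun z => by
    rw [Complex.star_def, Complex.mul_conj, Complex.normSq_eq_norm_sq]
  have hlln := h.tendsto_average (f := fun v => ((‖fourier v k‖ ^ 2 : ℝ) : ℂ))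
    (Complex.continuous_ofReal.comp (hc.norm.pow 2))
    (fun t v => by simp only [norm_fourier_cyclicShift]) (by
      simp only [hsq, fourier_smul_add]
      exact integrable_mul_star (memLp_linearForm _ _ _) (memLp_linearForm _ _ _))
  have hval : ∫ p, ((‖fourier (p.1 • θ + p.2) k‖ ^ 2 : ℝ) : ℂ) ∂jointLaw (ZMod L) lam (σ ^ 2) =
      ((lam * ‖fourier θ k‖ ^ 2 + (σ : ℝ) ^ 2 : ℝ) : ℂ) := by
    simp only [hsq, fourier_smul_add, integral_linearForm_mul_star, formCov_fourierForm, if_true]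
    rw [← hsq]
    push_cast
    ring
  rw [hval] at hlln
  filter_upwards [hlln] with w hw
  have hre := (Complex.continuous_re.tendsto _).comp hw
  have hlim := hre.sub_const ((σ : ℝ) ^ 2)
  convert hlim using 2
  · simp only [powerEst, Function.comp_apply]
    rw [← Complex.ofReal_sum, ← Complex.ofReal_natCast, ← Complex.ofReal_one, ← Complex.ofReal_div,
      ← Complex.ofReal_mul, Complex.ofReal_re]
  · rw [Complex.ofReal_re]
    ring

/-- The covariance of the stride-one products, up to a multiple of the identity. -/
lemma integral_strideProd_mul_star (θ : ZMod L → ℂ) (lam v : ℝ≥0) :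
    ∃ d : ℝ, ∀ k l : ZMod L,
      ∫ p, strideProd (p.1 • θ + p.2) k * star (strideProd (p.1 • θ + p.2) l)
        ∂jointLaw (ZMod L) lam v =
      2 * (lam : ℂ) ^ 2 * (strideProd θ k * star (strideProd θ l)) +
        if k = l then
          (v : ℂ) * (lam * ‖fourier θ k‖ ^ 2 + lam * ‖fourier θ (k + 1)‖ ^ 2) + (d : ℂ)
        else 0 := by
  have hsq : ∀ z : ℂ, (‖z‖ : ℂ) ^ 2 = z * star z := fun z => by
    rw [Complex.star_def, Complex.mul_conj, Complex.normSq_eq_norm_sq, Complex.ofReal_pow]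
  simp only [strideProd, fourier_smul_add, star_mul', star_star, ← mul_assoc]
  rcases (NeZero.one_le : 1 ≤ L).eq_or_lt with rfl | hL
  · refine ⟨2 * v * (lam * ‖fourier θ 0‖ ^ 2) + 2 * v ^ 2, fun k l => ?_⟩
    rw [integral_linearForm_fourth, Subsingleton.elim l 0, Subsingleton.elim (k + 1) 0,
      Subsingleton.elim (0 + 1 : ZMod 1) 0, Subsingleton.elim k 0]
    push_cast
    simp only [formCov_fourierForm, hsq, if_true]
    ring
  · have hne : ∀ k : ZMod L, k ≠ k + 1 := fun k hk => by
      have : Fact (1 < L) := ⟨hL⟩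
      exact one_ne_zero (left_eq_add.1 hk)
    -- For `L ≥ 2` the pairing of `k` with `k + 1` is free of noise; the other contributes `v²` when
    -- `k = l`.
    refine ⟨(v : ℝ) ^ 2, fun k l => ?_⟩
    rw [integral_linearForm_fourth]
    simp only [formCov_fourierForm, hsq, if_neg (hne k), if_neg (hne l).symm, add_left_inj,
      eq_comm (a := l)]
    split_ifs with hkl
    · subst hkl
      push_cast
      ring
    · ring

/-! ### Almost sure limit of the bias-corrected covariance -/

lemma covEst_apply (σ : ℝ≥0) (N : ℕ) (y : ℕ → ZMod L → ℂ) (k l : ZMod L) :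
    covEst σ N y k l =
      (1 / (N : ℂ)) * ∑ i ∈ Finset.range N, strideProd (y i) k * star (strideProd (y i) l) -
        if k = l then (((σ : ℝ) ^ 2 * (powerEst σ N y k + powerEst σ N y (k + 1)) : ℝ) : ℂ)
        else 0 := by
  simp [covEst, Matrix.sum_apply, Matrix.vecMulVec_apply, Matrix.diagonal_apply]

lemma isHermitian_covEst (σ : ℝ≥0) (N : ℕ) (y : ℕ → ZMod L → ℂ) :
    (covEst σ N y).IsHermitian := by
  ext k l
  rw [Matrix.conjTranspose_apply, covEst_apply, covEst_apply]
  simp only [star_sub, star_mul', star_sum, star_star, eq_comm (a := l), mul_comm (star _)]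
  split_ifs with hkl
  · subst hkl
    simp [mul_comm]
  · simp [mul_comm]

/-- The corrected sample covariance matrix converges to a matrix of rank one plus a multiple of
the identity. -/
lemma IsRankOneMRFA.tendsto_covEst [IsProbabilityMeasure P]
    (h : IsRankOneMRFA P θ lam σ a s η y) :
    ∃ d : ℝ, ∀ᵐ w ∂P, ∀ k l, Tendsto (fun N => covEst σ N (fun i => y i w) k l) atTop
      (𝓝 (2 * (lam : ℂ) ^ 2 * (strideProd θ k * star (strideProd θ l)) +
        if k = l then (d : ℂ) else 0)) := by
  obtain ⟨d, hd⟩ := integral_strideProd_mul_star θ lam (σ ^ 2)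
  refine ⟨d, ?_⟩
  have hc : ∀ k, Continuous fun v : ZMod L → ℂ => fourier v k := fun k =>
    (continuous_apply k).comp continuous_fourier
  have hcs : ∀ k, Continuous fun v : ZMod L → ℂ => strideProd v k := fun k =>
    (hc k).mul (hc (k + 1)).star
  have hcov : ∀ᵐ w ∂P, ∀ k l, Tendsto (fun N : ℕ => (1 / (N : ℂ)) * ∑ i ∈ Finset.range N,
      strideProd (y i w) k * star (strideProd (y i w) l)) atTop
      (𝓝 (∫ p, strideProd (p.1 • θ + p.2) k * star (strideProd (p.1 • θ + p.2) l)
        ∂jointLaw (ZMod L) lam (σ ^ 2))) := by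
    rw [ae_all_iff]
    intro k
    rw [ae_all_iff]
    intro l
    refine h.tendsto_average (f := fun v => strideProd v k * star (strideProd v l))
      ((hcs k).mul (hcs l).star) (fun t v => strideProd_mul_star_cyclicShift t v k l) ?_
    simp only [strideProd, fourier_smul_add, star_mul', star_star, ← mul_assoc]
    exact integrable_mul_star_mul_star_mul (memLp_linearForm _ _ _) (memLp_linearForm _ _ _)
      (memLp_linearForm _ _ _) (memLp_linearForm _ _ _)
  filter_upwards [hcov, ae_all_iff.2 h.tendsto_powerEst] with w hw hp k l
  simp only [covEst_apply]
  have hwkl := hw k l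
  rw [hd] at hwkl
  by_cases hkl : k = l
  · simp only [hkl, if_true] at hwkl ⊢
    -- The correction tends to exactly the `k`-dependent part of the noise diagonal, leaving `d`.
    have hpow := (Complex.continuous_ofReal.tendsto _).comp
      (((hp l).add (hp (l + 1))).const_mul ((σ : ℝ) ^ 2))
    refine (hwkl.sub hpow).congr' (Eventually.of_forall fun N => rfl) |>.trans (le_of_eq ?_)
    congr 1
    push_cast
    ring
  · simpa only [hkl, if_false, sub_zero] using hwkl

end Sampling

/-! ### Perturbation of the leading eigenvector -/

section Eigenvector

variable {L : ℕ} [NeZero L]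

open scoped ComplexOrder in
-- Passes from the largest eigenvalue to the largest Rayleigh quotient: each eigenvalue of `ev • 1 -
-- C` is `ev` minus an eigenvalue of `C`, so this Hermitian matrix is positive semidefinite.
lemma IsLeadingEigenvector.re_dotProduct_le {C : Matrix (ZMod L) (ZMod L) ℂ} {v : ZMod L → ℂ}
    (hC : C.IsHermitian) (hv : IsLeadingEigenvector C v) {x : ZMod L → ℂ} (hx : l2Norm x = 1) :
    (star x ⬝ᵥ (C *ᵥ x)).re ≤ (star v ⬝ᵥ (C *ᵥ v)).re := by
  obtain ⟨hv1, ev, hev, hmax⟩ := hv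
  have hnorm : ∀ z : ZMod L → ℂ, l2Norm z = 1 → star z ⬝ᵥ z = 1 := fun z hz => by
    rw [dotProduct_comm]
    exact (sum_mul_star_eq_l2Norm_sq z).trans (by simp [hz])
  set A : Matrix (ZMod L) (ZMod L) ℂ := (ev : ℂ) • 1 - C with hA
  have hAh : A.IsHermitian := by
    rw [hA, Matrix.IsHermitian, Matrix.conjTranspose_sub, Matrix.conjTranspose_smul, hC.eq]
    simp
  have hAx : ∀ z, A *ᵥ z = (ev : ℂ) • z - C *ᵥ z := fun z => by
    rw [hA, Matrix.sub_mulVec, Matrix.smul_mulVec, Matrix.one_mulVec]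
  have hpsd : A.PosSemidef := by
    rw [hAh.posSemidef_iff_eigenvalues_nonneg]
    intro i
    set b : ZMod L → ℂ := (hAh.eigenvectorBasis i).ofLp with hb
    have hb0 : b ≠ 0 := fun h0 => by
      have h1 := hAh.eigenvectorBasis.orthonormal.ne_zero i
      exact h1 (by ext j; exact congrFun h0 j)
    have h1 : A *ᵥ b = (hAh.eigenvalues i) • b := hAh.mulVec_eigenvectorBasis i
    have h2 : C *ᵥ b = ((ev - hAh.eigenvalues i : ℝ) : ℂ) • b := by
      rw [hAx] at h1
      rw [Complex.ofReal_sub, sub_smul, Complex.coe_smul (hAh.eigenvalues i), ← h1]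
      abel
    have h3 := hmax (ev - hAh.eigenvalues i)
      (Module.End.hasEigenvalue_of_hasEigenvector (x := b)
        ⟨Module.End.mem_eigenspace_iff.2 (by rw [Matrix.toLin'_apply, h2]), hb0⟩)
    simpa using h3
  have h := hpsd.re_dotProduct_nonneg x
  rw [hAx, dotProduct_sub, dotProduct_smul, hnorm x hx] at h
  rw [hev, dotProduct_smul, hnorm v hv1]
  simpa using h

/-- The matrix `κ u u* + d`. -/
def spikedMatrix (κ d : ℝ) (u : ZMod L → ℂ) : Matrix (ZMod L) (ZMod L) ℂ := fun k l =>
  (κ : ℂ) * (u k * star (u l)) + if k = l then (d : ℂ) else 0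

lemma dotProduct_spikedMatrix_mulVec (κ d : ℝ) (u x : ZMod L → ℂ) (hx : l2Norm x = 1) :
    star x ⬝ᵥ (spikedMatrix κ d u *ᵥ x) = ((κ * ‖star u ⬝ᵥ x‖ ^ 2 + d : ℝ) : ℂ) := by
  have h1 : spikedMatrix κ d u *ᵥ x = ((κ : ℂ) * (star u ⬝ᵥ x)) • u + (d : ℂ) • x := by
    ext k
    simp only [Matrix.mulVec, dotProduct, spikedMatrix, add_mul, Finset.sum_add_distrib, ite_mul,
      zero_mul, Finset.sum_ite_eq, Finset.mem_univ, if_true, Pi.add_apply, Pi.smul_apply,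
      smul_eq_mul, Pi.star_apply, Finset.mul_sum, Finset.sum_mul]
    congr 1
    exact Finset.sum_congr rfl fun l _ => by ring
  have h2 : star x ⬝ᵥ x = 1 := by
    rw [dotProduct_comm]
    exact (sum_mul_star_eq_l2Norm_sq x).trans (by simp [hx])
  have h3 : star x ⬝ᵥ u = star (star u ⬝ᵥ x) := Matrix.star_dotProduct _ _
  rw [h1, dotProduct_add, dotProduct_smul, dotProduct_smul, h2, h3, smul_eq_mul, smul_eq_mul,
    mul_assoc, Complex.star_def, Complex.mul_conj, Complex.normSq_eq_norm_sq]
  push_cast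
  ring

lemma norm_apply_le_l2Norm (x : ZMod L → ℂ) (k : ZMod L) : ‖x k‖ ≤ l2Norm x :=
  PiLp.norm_apply_le (WithLp.toLp 2 x) k

lemma norm_dotProduct_mulVec_le (D : Matrix (ZMod L) (ZMod L) ℂ) {x : ZMod L → ℂ}
    (hx : l2Norm x = 1) : ‖star x ⬝ᵥ (D *ᵥ x)‖ ≤ ∑ k, ∑ l, ‖D k l‖ := by
  have h1 : ∀ k, ‖x k‖ ≤ 1 := fun k => hx ▸ norm_apply_le_l2Norm x k
  refine (norm_sum_le _ _).trans (Finset.sum_le_sum fun k _ => ?_)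
  rw [norm_mul, Pi.star_apply, norm_star]
  refine (mul_le_of_le_one_left (norm_nonneg _) (h1 k)).trans ?_
  refine (norm_sum_le _ _).trans (Finset.sum_le_sum fun l _ => ?_)
  rw [norm_mul]
  exact mul_le_of_le_one_right (norm_nonneg _) (h1 l)

lemma sum_norm_sub_projection_sq {u v : ZMod L → ℂ} (hu : l2Norm u = 1) (hv : l2Norm v = 1) :
    ∑ k, ‖v k - (star u ⬝ᵥ v) * u k‖ ^ 2 = 1 - ‖star u ⬝ᵥ v‖ ^ 2 := by
  set t := star u ⬝ᵥ v with ht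
  have hu2 := sum_mul_star_eq_l2Norm_sq u
  have hv2 := sum_mul_star_eq_l2Norm_sq v
  rw [hu] at hu2
  rw [hv] at hv2
  have ht1 : ∑ k, v k * star (u k) = t := by
    rw [ht, dotProduct_comm]; rfl
  have ht2 : ∑ k, u k * star (v k) = star t := by
    rw [← ht1, star_sum]
    exact Finset.sum_congr rfl fun k _ => by simp [mul_comm]
  have hsq : ∀ z : ℂ, ((‖z‖ ^ 2 : ℝ) : ℂ) = z * star z := fun z => by
    rw [Complex.star_def, Complex.mul_conj, Complex.normSq_eq_norm_sq]
  apply Complex.ofReal_injective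
  rw [Complex.ofReal_sum, Complex.ofReal_sub, hsq]
  calc ∑ k, ((‖v k - t * u k‖ ^ 2 : ℝ) : ℂ)
      = ∑ k, (v k * star (v k) - star t * (v k * star (u k)) - t * (u k * star (v k)) +
          t * star t * (u k * star (u k))) := Finset.sum_congr rfl fun k _ => by
        rw [hsq, star_sub, star_mul']; ring
    _ = _ := by
        rw [Finset.sum_add_distrib, Finset.sum_sub_distrib, Finset.sum_sub_distrib,
          ← Finset.mul_sum, ← Finset.mul_sum, ← Finset.mul_sum, ht1, ht2, hu2, hv2]
        push_cast
        ring

/-- A quantitative perturbation bound for the leading eigenvector. -/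
lemma IsLeadingEigenvector.one_sub_overlap_le {C : Matrix (ZMod L) (ZMod L) ℂ}
    {u v : ZMod L → ℂ} {κ d : ℝ} (hκ : 0 < κ) (hC : C.IsHermitian)
    (hv : IsLeadingEigenvector C v) (hu : l2Norm u = 1) :
    1 - ‖star u ⬝ᵥ v‖ ^ 2 ≤ 2 / κ * ∑ k, ∑ l, ‖C k l - spikedMatrix κ d u k l‖ := by
  -- Comparing the quotients at `u` and `v` gives `κ + d + ⟨u, D u⟩ ≤ κ |⟨u, v⟩|² + d + ⟨v, D v⟩` in
  -- real parts. The shift `d` cancels, and the two error terms produce the factor `2`.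
  have hle := hv.re_dotProduct_le hC hu
  set D := C - spikedMatrix κ d u with hD
  have hCD : C = spikedMatrix κ d u + D := by rw [hD]; abel
  have hform : ∀ x, l2Norm x = 1 → (star x ⬝ᵥ (C *ᵥ x)).re =
      κ * ‖star u ⬝ᵥ x‖ ^ 2 + d + (star x ⬝ᵥ (D *ᵥ x)).re := fun x hx => by
    rw [hCD, Matrix.add_mulVec, dotProduct_add, dotProduct_spikedMatrix_mulVec κ d u x hx,
      Complex.add_re, Complex.ofReal_re]
  rw [hform u hu, hform v hv.1] at hle
  have huu : ‖star u ⬝ᵥ u‖ = 1 := by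
    rw [dotProduct_comm, show u ⬝ᵥ star u = _ from sum_mul_star_eq_l2Norm_sq u, hu]
    simp
  have h1 := (Complex.abs_re_le_norm _).trans (norm_dotProduct_mulVec_le D hu)
  have h2 := (Complex.abs_re_le_norm _).trans (norm_dotProduct_mulVec_le D hv.1)
  rw [abs_le] at h1 h2
  rw [huu] at hle
  have : κ * (1 - ‖star u ⬝ᵥ v‖ ^ 2) ≤ 2 * ∑ k, ∑ l, ‖D k l‖ := by linarith [h1.1, h2.2]
  rw [div_mul_eq_mul_div, le_div_iff₀ hκ]
  linarith [show ∑ k, ∑ l, ‖C k l - spikedMatrix κ d u k l‖ = ∑ k, ∑ l, ‖D k l‖ from rfl]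

/-- Eigenvectors are determined only up to a phase. With `t = ⟨u, v⟩`, multiplying by `star t`
suffices for alignment: the error is `star t (v - t u) - (1 - |t|²) u`, and both terms are
controlled by `1 - |t|²`. -/
lemma tendsto_aligned_eigenvector {C : ℕ → Matrix (ZMod L) (ZMod L) ℂ} {u : ZMod L → ℂ}
    {v : ℕ → ZMod L → ℂ} {κ d : ℝ} (hκ : 0 < κ) (hC : ∀ N, (C N).IsHermitian)
    (hv : ∀ᶠ N in atTop, IsLeadingEigenvector (C N) (v N)) (hu : l2Norm u = 1)
    (hlim : ∀ k l, Tendsto (fun N => C N k l) atTop (𝓝 (spikedMatrix κ d u k l))) (k : ZMod L) :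
    Tendsto (fun N => star (star u ⬝ᵥ v N) * v N k) atTop (𝓝 (u k)) := by
  have hε : Tendsto (fun N => 2 / κ * ∑ k, ∑ l, ‖C N k l - spikedMatrix κ d u k l‖) atTop
      (𝓝 0) := by
    have h0 : ∀ k l, Tendsto (fun N => ‖C N k l - spikedMatrix κ d u k l‖) atTop (𝓝 0) :=
      fun k l => tendsto_iff_norm_sub_tendsto_zero.1 (hlim k l)
    have := (tendsto_finsetSum Finset.univ fun k _ =>
      tendsto_finsetSum Finset.univ fun l _ => h0 k l).const_mul (2 / κ)
    simpa using this
  have hover : Tendsto (fun N => 1 - ‖star u ⬝ᵥ v N‖ ^ 2) atTop (𝓝 0) := by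
    refine tendsto_of_tendsto_of_tendsto_of_le_of_le' tendsto_const_nhds hε ?_ ?_
    · filter_upwards [hv] with N hN
      rw [← sum_norm_sub_projection_sq hu hN.1]
      positivity
    · filter_upwards [hv] with N hN
      exact hN.one_sub_overlap_le hκ (hC N) hu
  have hproj : Tendsto (fun N => ‖v N k - (star u ⬝ᵥ v N) * u k‖) atTop (𝓝 0) := by
    have hsqrt := (Real.continuous_sqrt.tendsto 0).comp hover
    rw [Real.sqrt_zero] at hsqrt
    refine squeeze_zero' (Eventually.of_forall fun N => norm_nonneg _) ?_ hsqrt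
    filter_upwards [hv] with N hN
    refine Real.le_sqrt_of_sq_le ?_
    change _ ≤ 1 - ‖star u ⬝ᵥ v N‖ ^ 2
    rw [← sum_norm_sub_projection_sq hu hN.1]
    exact Finset.single_le_sum (f := fun k => ‖v N k - (star u ⬝ᵥ v N) * u k‖ ^ 2)
      (fun _ _ => sq_nonneg _) (Finset.mem_univ k)
  rw [tendsto_iff_norm_sub_tendsto_zero]
  have hsum := hproj.add (hover.mul_const ‖u k‖)
  rw [zero_mul, add_zero] at hsum
  refine squeeze_zero' (Eventually.of_forall fun N => norm_nonneg _) ?_ hsum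
  filter_upwards [hv] with N hN
  set t := star u ⬝ᵥ v N
  have hnn : 0 ≤ 1 - ‖t‖ ^ 2 := by
    rw [← sum_norm_sub_projection_sq hu hN.1]
    positivity
  have hsplit : star t * v N k - u k =
      star t * (v N k - t * u k) - ((1 - ‖t‖ ^ 2 : ℝ) : ℂ) * u k := by
    have : ((‖t‖ ^ 2 : ℝ) : ℂ) = t * star t := by
      rw [Complex.star_def, Complex.mul_conj, Complex.normSq_eq_norm_sq]
    rw [Complex.ofReal_sub, this, Complex.ofReal_one]
    ring
  rw [hsplit]
  refine (norm_sub_le _ _).trans (add_le_add ?_ ?_)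
  · rw [norm_mul, norm_star]
    exact mul_le_of_le_one_left (norm_nonneg _) (by nlinarith [norm_nonneg t])
  · rw [norm_mul, Complex.norm_real, Real.norm_of_nonneg hnn]

end Eigenvector

/-! ### Phases -/

section Phases

/-- The phase `z / |z|`. -/
def phase (z : ℂ) : ℂ := z / ‖z‖

lemma phase_mul (z w : ℂ) : phase (z * w) = phase z * phase w := by
  simp only [phase, norm_mul, Complex.ofReal_mul, mul_div_mul_comm]

lemma phase_star (z : ℂ) : phase (star z) = star (phase z) := by
  simp [phase]

lemma norm_phase {z : ℂ} (hz : z ≠ 0) : ‖phase z‖ = 1 := by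
  simp [phase, hz]

lemma phase_of_norm_eq_one {z : ℂ} (hz : ‖z‖ = 1) : phase z = z := by
  simp [phase, hz]

lemma phase_ofReal_pos {r : ℝ} (hr : 0 < r) : phase (r : ℂ) = 1 := by
  simp [phase, abs_of_pos hr, hr.ne']

lemma mul_star_of_norm_eq_one {z : ℂ} (hz : ‖z‖ = 1) : z * star z = 1 := by
  rw [Complex.star_def, Complex.mul_conj, Complex.normSq_eq_norm_sq, hz]
  simp

lemma phase_mul_norm (z : ℂ) : phase z * ‖z‖ = z := by
  by_cases hz : z = 0
  · simp [hz, phase]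
  · exact div_mul_cancel₀ _ (by simpa using hz)

lemma continuousAt_phase {z : ℂ} (hz : z ≠ 0) : ContinuousAt phase z :=
  continuousAt_id.div (Complex.continuous_ofReal.comp continuous_norm).continuousAt
    (by simpa using hz)

lemma exp_argFrom (c : ℝ) {z : ℂ} (hz : z ≠ 0) :
    Complex.exp ((argFrom c z : ℂ) * Complex.I) = phase z := by
  have h1 : (argFrom c z : ℝ) = z.arg - toIocDiv Real.two_pi_pos c z.arg • (2 * Real.pi) :=
    (self_sub_toIocDiv_zsmul _ _ _).symm
  have h2 : Complex.exp ((z.arg : ℂ) * Complex.I) = phase z := by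
    rw [phase, eq_div_iff (by simpa using hz), mul_comm]
    exact Complex.norm_mul_exp_arg_mul_I z
  rw [h1, ← h2]
  push_cast
  rw [sub_mul, zsmul_eq_mul, mul_assoc, Complex.exp_sub, Complex.exp_int_mul_two_pi_mul_I, div_one]

lemma argFrom_mem_Ioc (c : ℝ) (z : ℂ) : argFrom c z ∈ Set.Ioc c (c + 2 * Real.pi) :=
  toIocMod_mem_Ioc _ _ _

lemma argFrom_eq_of_exp {c x : ℝ} {z : ℂ} (hz : z ≠ 0) (hx : x ∈ Set.Ioc c (c + 2 * Real.pi))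
    (h : Complex.exp ((x : ℂ) * Complex.I) = phase z) : argFrom c z = x := by
  have h2 : Complex.exp ((z.arg : ℂ) * Complex.I) = phase z := by
    rw [phase, eq_div_iff (by simpa using hz), mul_comm]
    exact Complex.norm_mul_exp_arg_mul_I z
  rw [← h] at h2
  obtain ⟨n, hn⟩ := Complex.exp_eq_exp_iff_exists_int.1 h2
  refine (toIocMod_eq_iff _).2 ⟨hx, n, ?_⟩
  have h3 : (z.arg : ℂ) = ((x + n * (2 * Real.pi) : ℝ) : ℂ) := by
    apply mul_right_cancel₀ Complex.I_ne_zero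
    rw [hn]
    push_cast
    ring
  rw [zsmul_eq_mul]
  exact_mod_cast h3

variable {L : ℕ}

/-- Exponentiation erases the choice of branch: the marched phases depend only on the phases of `u`.
-/
lemma frequencyMarching_eq_prod (c : ℝ) {u : ZMod L → ℂ} (hu : ∀ k, u k ≠ 0) (k : ZMod L) :
    frequencyMarching c u k = ∏ l ∈ Finset.range k.val, star (phase (u (l : ZMod L))) := by
  rw [frequencyMarching, Complex.ofReal_sum, Finset.mul_sum, Complex.exp_sum]
  refine Finset.prod_congr rfl fun l _ => ?_
  rw [← exp_argFrom c (hu _), Complex.star_def, ← Complex.exp_conj]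
  congr 1
  simp [mul_comm]

variable [NeZero L]

/-- The scalar by which `phaseCorrection` multiplies. -/
def correctionPhase (c : ℝ) (u : ZMod L → ℂ) : ℂ :=
  Complex.exp (-(Complex.I / (L : ℂ)) * ((∑ k, argFrom c (u k) : ℝ) : ℂ))

lemma norm_correctionPhase (c : ℝ) (u : ZMod L → ℂ) : ‖correctionPhase c u‖ = 1 := by
  have h : -(Complex.I / (L : ℂ)) * ((∑ k, argFrom c (u k) : ℝ) : ℂ) =
      ((-(∑ k, argFrom c (u k)) / L : ℝ) : ℂ) * Complex.I := by
    push_cast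
    ring
  rw [correctionPhase, h, Complex.norm_exp_ofReal_mul_I]

lemma correctionPhase_pow (c : ℝ) {u : ZMod L → ℂ} (hu : ∀ k, u k ≠ 0) :
    correctionPhase c u ^ L = ∏ k, star (phase (u k)) := by
  have hL : (L : ℂ) ≠ 0 := Nat.cast_ne_zero.2 (NeZero.ne L)
  have h : (L : ℂ) * (-(Complex.I / (L : ℂ)) * ((∑ k, argFrom c (u k) : ℝ) : ℂ)) =
      ∑ k, -Complex.I * (argFrom c (u k) : ℂ) := by
    rw [← Finset.mul_sum, Complex.ofReal_sum]
    field_simp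
  rw [correctionPhase, ← Complex.exp_nat_mul, h, Complex.exp_sum]
  refine Finset.prod_congr rfl fun l _ => ?_
  rw [← exp_argFrom c (hu _), Complex.star_def, ← Complex.exp_conj]
  congr 1
  simp [mul_comm]

lemma norm_rootPhase (j : ℕ) : ‖rootPhase L j‖ = 1 := by
  rw [← stdAddChar_natCast]
  exact norm_stdAddChar _

lemma stdAddChar_pow (x : ZMod L) : (ZMod.stdAddChar x : ℂ) ^ L = 1 := by
  rw [← AddChar.map_nsmul_eq_pow]
  simp

lemma rootPhase_pow (j : ℕ) : rootPhase L j ^ L = 1 := by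
  rw [← stdAddChar_natCast]
  exact stdAddChar_pow _

lemma exists_stdAddChar_eq {z : ℂ} (hz : z ^ L = 1) : ∃ r : ZMod L, ZMod.stdAddChar r = z := by
  have hL : (L : ℂ) ≠ 0 := Nat.cast_ne_zero.2 (NeZero.ne L)
  obtain ⟨i, _, hi⟩ := (Complex.isPrimitiveRoot_exp L (NeZero.ne L)).eq_pow_of_pow_eq_one hz
  refine ⟨(i : ZMod L), ?_⟩
  rw [stdAddChar_natCast, rootPhase, ← hi, ← Complex.exp_nat_mul]
  congr 1
  ring

/-- If the argument exceeded `c + 2π/L`, a further rotation by `-2π/L` would stay in the window `(c,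
c + 2π]` and lower it. -/
lemma IsMinimalPhaseIndex.argFrom_le {c : ℝ} {u : ZMod L → ℂ} {j : ℕ}
    (h : IsMinimalPhaseIndex c u j) (hu : u 0 ≠ 0) :
    argFrom c (u 0 * rootPhase L j) ≤ c + 2 * Real.pi / L := by
  have hL : (0 : ℝ) < L := Nat.cast_pos.2 (NeZero.pos L)
  by_contra! hlt
  set z := u 0 * rootPhase L j with hz
  have hz0 : z ≠ 0 := mul_ne_zero hu (norm_ne_zero_iff.1 (by rw [norm_rootPhase]; exact one_ne_zero))
  -- The index `j - 1` taken modulo `L`, so that `j = 0` wraps around and the bound `j' < L` holds.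
  set j' := ((j : ZMod L) - 1).val
  have hroot : u 0 * rootPhase L j' = z * ZMod.stdAddChar (-1 : ZMod L) := by
    rw [← stdAddChar_natCast, ZMod.natCast_val, ZMod.cast_id, hz, ← stdAddChar_natCast, mul_assoc,
      ← AddChar.map_add_eq_mul, sub_eq_add_neg]
  have hone : ZMod.stdAddChar (-1 : ZMod L) =
      Complex.exp (((-(2 * Real.pi / L) : ℝ) : ℂ) * Complex.I) := by
    have := ZMod.stdAddChar_coe (N := L) (-1)
    push_cast at this
    rw [this]
    congr 1
    push_cast
    ring
  have hnew : argFrom c (z * ZMod.stdAddChar (-1 : ZMod L)) = argFrom c z - 2 * Real.pi / L := by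
    have hn1 : ‖(ZMod.stdAddChar (-1 : ZMod L) : ℂ)‖ = 1 := norm_stdAddChar _
    refine argFrom_eq_of_exp (mul_ne_zero hz0 (norm_ne_zero_iff.1 (by rw [hn1]; exact one_ne_zero)))
      ⟨by linarith, ?_⟩ ?_
    · have := (argFrom_mem_Ioc c z).2
      have : 0 < 2 * Real.pi / L := by positivity
      linarith
    · rw [phase_mul, phase_of_norm_eq_one hn1, hone, ← exp_argFrom c hz0, ← Complex.exp_add]
      congr 1
      push_cast
      ring
  have hmin := h.2 j' (ZMod.val_lt _)
  rw [hroot, hnew] at hmin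
  have : 0 < 2 * Real.pi / L := by positivity
  linarith

lemma phase_strideProd (θ : ZMod L → ℂ) (k : ZMod L) :
    phase (strideProd θ k) = phase (fourier θ k) * star (phase (fourier θ (k + 1))) := by
  rw [strideProd, phase_mul, phase_star]

/-- The phases telescope around the whole cycle. -/
lemma prod_star_phase_strideProd {θ : ZMod L → ℂ} (hθ : ∀ k, fourier θ k ≠ 0) :
    ∏ k, star (phase (strideProd θ k)) = 1 := by
  have h := Equiv.prod_comp (Equiv.addRight (1 : ZMod L)) fun k => phase (fourier θ k)
  simp only [Equiv.coe_addRight] at h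
  simp only [phase_strideProd, star_mul', star_star, Finset.prod_mul_distrib, h]
  rw [← Finset.prod_mul_distrib]
  exact Finset.prod_eq_one fun k _ => by rw [mul_comm, mul_star_of_norm_eq_one (norm_phase (hθ k))]

lemma prod_range_star_phase_strideProd {θ : ZMod L → ℂ} (hθ : ∀ k, fourier θ k ≠ 0) (n : ℕ) :
    ∏ l ∈ Finset.range n, star (phase (strideProd θ (l : ZMod L))) =
      star (phase (fourier θ 0)) * phase (fourier θ (n : ZMod L)) := by
  induction n with
  | zero => simpa [mul_comm] using (mul_star_of_norm_eq_one (norm_phase (hθ 0))).symm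
  | succ n ih =>
    rw [Finset.prod_range_succ, ih, phase_strideProd, star_mul', star_star, Nat.cast_succ]
    linear_combination (star (phase (fourier θ 0)) * phase (fourier θ ((n : ZMod L) + 1))) *
      mul_star_of_norm_eq_one (norm_phase (hθ (n : ZMod L)))

/-! ### Selecting the root of unity -/

/-- Rounds `ρ` to a root of unity: `e = exp (-i arg (ρ ^ L) / L)` makes `ρ e` an exact root, and `e
→ 1` because `arg` is continuous at `1`. -/
lemma exists_shift_of_tendsto_pow {ρ : ℕ → ℂ} (hρ : ∀ᶠ N in atTop, ‖ρ N‖ = 1)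
    (hpow : Tendsto (fun N => ρ N ^ L) atTop (𝓝 1)) :
    ∃ r : ℕ → ZMod L, Tendsto (fun N => ZMod.stdAddChar (-(r N)) * star (ρ N)) atTop (𝓝 1) := by
  have hL : (L : ℂ) ≠ 0 := Nat.cast_ne_zero.2 (NeZero.ne L)
  set e : ℕ → ℂ := fun N => Complex.exp (((-((ρ N ^ L).arg / L) : ℝ) : ℂ) * Complex.I)
  have he : Tendsto e atTop (𝓝 1) := by
    have harg := (Complex.continuousAt_arg Complex.one_mem_slitPlane).tendsto.comp hpow
    rw [Complex.arg_one] at harg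
    have hcont : Continuous fun x : ℝ => Complex.exp (((-(x / L) : ℝ) : ℂ) * Complex.I) := by
      fun_prop
    have := (hcont.tendsto 0).comp harg
    simpa [e, Function.comp_def] using this
  have hroot : ∀ N, ∃ r : ZMod L, ‖ρ N‖ = 1 → ZMod.stdAddChar (-r) = ρ N * e N := by
    intro N
    by_cases hN : ‖ρ N‖ = 1
    · have h1 : (ρ N * e N) ^ L = 1 := by
        have h2 : ρ N ^ L = Complex.exp (((ρ N ^ L).arg : ℂ) * Complex.I) := by
          conv_lhs => rw [← Complex.norm_mul_exp_arg_mul_I (ρ N ^ L)]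
          simp [norm_pow, hN]
        rw [mul_pow, ← Complex.exp_nat_mul, h2, ← Complex.exp_add, ← h2]
        convert Complex.exp_zero using 2
        push_cast
        field_simp
        ring
      obtain ⟨r, hr⟩ := exists_stdAddChar_eq h1
      exact ⟨-r, fun _ => by rw [neg_neg, hr]⟩
    · exact ⟨0, fun h => absurd h hN⟩
  choose r hr using hroot
  refine ⟨r, he.congr' ?_⟩
  filter_upwards [hρ] with N hN
  rw [hr N hN]
  linear_combination (-e N) * mul_star_of_norm_eq_one hN

/-- On the half-open arc `(c, c + 2π/L]` a unit number is a function of its `L`-th power, continuous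
away from the image of the endpoints. As `ρ ^ L → 1`, the power of `ρ Q` tends to `b ^ L`, so `ρ Q`
converges and `ρ` tends to a root of unity fixed by `b`, `c` and `L`. Choosing `r` before `ρ` and
`Q` makes it independent of the realization. -/
lemma exists_fixed_shift (c : ℝ) {b : ℂ} (hb : ‖b‖ = 1)
    (hne : (Complex.exp (-(c : ℂ) * Complex.I) * b) ^ L ≠ 1) :
    ∃ r : ZMod L, ∀ ρ Q : ℕ → ℂ, Tendsto Q atTop (𝓝 b) → (∀ᶠ N in atTop, ‖Q N‖ = 1) →
      Tendsto (fun N => ρ N ^ L) atTop (𝓝 1) →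
      (∀ᶠ N in atTop, ∃ x ∈ Set.Ioc 0 (2 * Real.pi / L),
        ρ N * Q N = Complex.exp (((c + x : ℝ) : ℂ) * Complex.I)) →
      Tendsto (fun N => ZMod.stdAddChar (-r) * star (ρ N)) atTop (𝓝 1) := by
  have hL : (0 : ℝ) < L := Nat.cast_pos.2 (NeZero.pos L)
  have hLC : (L : ℂ) ≠ 0 := Nat.cast_ne_zero.2 (NeZero.ne L)
  set E := Complex.exp (-(c : ℂ) * Complex.I) with hE
  -- The sign places the cut of `arg` at the endpoints of the arc: for `z = exp (i (c + x))` the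
  -- number `-(E z) ^ L` has argument `L x - π`.
  set Z : ℂ := -(E * b) ^ L with hZ
  have hEn : ‖E‖ = 1 := by
    rw [hE, ← Complex.ofReal_neg, Complex.norm_exp_ofReal_mul_I]
  have hZn : ‖Z‖ = 1 := by simp [hZ, norm_pow, hEn, hb]
  have hZs : Z ∈ Complex.slitPlane := by
    rw [Complex.mem_slitPlane_iff_arg]
    refine ⟨fun harg => hne ?_, norm_ne_zero_iff.1 (by rw [hZn]; exact one_ne_zero)⟩
    have := Complex.norm_mul_exp_arg_mul_I Z
    rw [harg, hZn, Complex.exp_pi_mul_I] at this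
    have h2 : (E * b) ^ L = -Z := by rw [hZ, neg_neg]
    rw [h2, ← this]
    simp
  -- Recovers the point of the arc, solving `arg = L x - π` for `x`.
  set G : ℂ → ℂ := fun z => Complex.exp (((c + (Real.pi + z.arg) / L : ℝ) : ℂ) * Complex.I)
  have hGc : ContinuousAt G Z := by
    have hcont : Continuous fun x : ℝ =>
        Complex.exp (((c + (Real.pi + x) / L : ℝ) : ℂ) * Complex.I) := by fun_prop
    exact hcont.continuousAt.comp (Complex.continuousAt_arg hZs)
  have hGpow : (G Z * star b) ^ L = 1 := by
    have h1 : G Z ^ L = -(star E) ^ L * Z := by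
      conv_rhs => rw [← Complex.norm_mul_exp_arg_mul_I Z, hZn]
      rw [← Complex.exp_nat_mul, hE, Complex.star_def, ← Complex.exp_conj, ← Complex.exp_nat_mul,
        Complex.ofReal_one, one_mul, neg_mul, ← Complex.exp_add, ← neg_one_mul,
        ← Complex.exp_pi_mul_I, ← Complex.exp_add]
      congr 1
      simp
      field_simp
      ring
    have h2 := mul_star_of_norm_eq_one hEn
    have h3 := mul_star_of_norm_eq_one hb
    rw [mul_pow, h1, hZ, neg_mul_neg, ← mul_pow, ← mul_pow]
    rw [show star E * (E * b) * star b = (E * star E) * (b * star b) by ring, h2, h3]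
    simp
  obtain ⟨r, hr⟩ := exists_stdAddChar_eq hGpow
  refine ⟨-r, fun ρ Q hQ hQn hpow hx => ?_⟩
  rw [neg_neg, hr]
  have hW : Tendsto (fun N => -(E * Q N) ^ L * ρ N ^ L) atTop (𝓝 Z) := by
    have := (((hQ.const_mul E).pow L).neg).mul hpow
    rwa [mul_one] at this
  have hlim : Tendsto (fun N => G Z * star b * star (G (-(E * Q N) ^ L * ρ N ^ L) * star (Q N)))
      atTop (𝓝 (G Z * star b * star (G Z * star b))) :=
    ((((hGc.tendsto.comp hW).mul hQ.star)).star).const_mul _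
  have hGn : ‖G Z * star b‖ = 1 := by
    rw [norm_mul, norm_star, hb, Complex.norm_exp_ofReal_mul_I, one_mul]
  rw [mul_star_of_norm_eq_one hGn] at hlim
  refine hlim.congr' ?_
  filter_upwards [hx, hQn] with N ⟨x, hx, hN⟩ hQN
  have hxL : (L : ℝ) * x - Real.pi ∈ Set.Ioc (-Real.pi) Real.pi := by
    have h1 : (L : ℝ) * x ≤ 2 * Real.pi := by
      have := mul_le_mul_of_nonneg_left hx.2 hL.le
      rwa [mul_div_cancel₀ _ hL.ne'] at this
    have h2 : 0 < (L : ℝ) * x := mul_pos hL hx.1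
    exact ⟨by linarith, by linarith⟩
  have harg : (-(E * Q N) ^ L * ρ N ^ L).arg = (L : ℝ) * x - Real.pi := by
    have : -(E * Q N) ^ L * ρ N ^ L =
        Complex.exp ((((L : ℝ) * x - Real.pi : ℝ) : ℂ) * Complex.I) := by
      rw [neg_mul, ← mul_pow, show E * Q N * ρ N = E * (ρ N * Q N) by ring, hN, hE,
        ← Complex.exp_add, ← Complex.exp_nat_mul, Complex.ofReal_sub, sub_mul, Complex.exp_sub,
        Complex.exp_pi_mul_I, div_neg, div_one]
      congr 2
      push_cast
      ring
    rw [this, Complex.exp_mul_I, Complex.arg_cos_add_sin_mul_I hxL]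
  have hG : G (-(E * Q N) ^ L * ρ N ^ L) = ρ N * Q N := by
    rw [hN]
    simp only [G, harg]
    congr 3
    field_simp
    ring
  rw [hG]
  have := mul_star_of_norm_eq_one hQN
  rw [mul_assoc (ρ N), this, mul_one]

end Phases

/-! ### Consistency for a fixed data sequence -/

section Deterministic

variable {L : ℕ} [NeZero L]

/-- By Parseval and `‖θ‖ = 1`, the estimate `λ̃` tends to `λ`. -/
lemma tendsto_magnitudeEst {θ : ZMod L → ℂ} (hθ : l2Norm θ = 1) {lam : ℝ≥0} (hlam : 0 < lam)
    {σ : ℝ≥0} {y : ℕ → ZMod L → ℂ}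
    (hp : ∀ k, Tendsto (fun N => powerEst σ N y k) atTop (𝓝 (lam * ‖fourier θ k‖ ^ 2)))
    (k : ZMod L) :
    Tendsto (fun N => magnitudeEst σ N y k) atTop (𝓝 ‖fourier θ k‖) := by
  have hlam' : (0 : ℝ) < lam := hlam
  have hl : Tendsto (fun N => lamEst σ N y) atTop (𝓝 (lam : ℝ)) := by
    have h := tendsto_finsetSum Finset.univ fun k _ => (hp k).abs
    have hsum : ∑ k, |(lam : ℝ) * ‖fourier θ k‖ ^ 2| = lam := by
      have h1 : ∀ k, |(lam : ℝ) * ‖fourier θ k‖ ^ 2| = lam * ‖fourier θ k‖ ^ 2 := fun k =>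
        abs_of_nonneg (by positivity)
      simp only [h1]
      rw [← Finset.mul_sum, ← l2Norm_sq, l2Norm_fourier, hθ]
      ring
    rwa [hsum] at h
  have h := (Real.continuous_sqrt.tendsto _).comp ((hp k).div hl hlam'.ne')
  rwa [mul_div_cancel_left₀ _ hlam'.ne', Real.sqrt_sq (norm_nonneg _)] at h

lemma tendsto_l2Norm_sub_of_tendsto_fourier {θ : ZMod L → ℂ} {α : ℂ} (hα : ‖α‖ = 1)
    {x : ℕ → ZMod L → ℂ}
    (hx : ∀ k, Tendsto (fun N => x N k) atTop (𝓝 (star α * fourier θ k))) :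
    Tendsto (fun N => l2Norm (θ - α • ((dftMatrix L)ᴴ *ᵥ x N))) atTop (𝓝 0) := by
  have hx' : Tendsto x atTop (𝓝 (star α • fourier θ)) := tendsto_pi_nhds.2 hx
  have hc : Continuous fun z : ZMod L → ℂ => l2Norm (θ - α • ((dftMatrix L)ᴴ *ᵥ z)) := by
    refine (PiLp.continuous_toLp 2 _).norm.comp ?_
    exact continuous_const.sub
      ((Continuous.matrix_mulVec continuous_const continuous_id).const_smul α)
  have h := (hc.tendsto _).comp hx'
  have h0 : l2Norm (θ - α • ((dftMatrix L)ᴴ *ᵥ (star α • fourier θ))) = 0 := by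
    rw [Matrix.mulVec_smul, conjTranspose_mulVec_fourier, smul_smul, mul_star_of_norm_eq_one hα,
      one_smul, sub_self]
    simp [l2Norm]
  rwa [h0] at h

/-- The phases of the leading eigenvectors, up to a common phase, converge to those of the
stride-one products of the true signal. -/
lemma tendsto_phase_eigenvector {θ : ZMod L → ℂ} (hpos : ∀ k, fourier θ k ≠ 0) {lam : ℝ≥0}
    (hlam : 0 < lam) {d : ℝ} {C : ℕ → Matrix (ZMod L) (ZMod L) ℂ} (hC : ∀ N, (C N).IsHermitian)
    (hlim : ∀ k l, Tendsto (fun N => C N k l) atTop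
      (𝓝 (2 * (lam : ℂ) ^ 2 * (strideProd θ k * star (strideProd θ l)) +
        if k = l then (d : ℂ) else 0)))
    {v : ℕ → ZMod L → ℂ} (hv : ∀ᶠ N in atTop, IsLeadingEigenvector (C N) (v N)) :
    ∃ τ : ℕ → ℂ, (∀ᶠ N in atTop, ‖τ N‖ = 1) ∧ (∀ᶠ N in atTop, ∀ k, v N k ≠ 0) ∧
      ∀ k, Tendsto (fun N => star (τ N) * phase (v N k)) atTop (𝓝 (phase (strideProd θ k))) := by
  have hs : ∀ k, strideProd θ k ≠ 0 := fun k => mul_ne_zero (hpos k) (star_ne_zero.2 (hpos _))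
  set m := l2Norm (strideProd θ) with hm
  have hm0 : 0 < m := (norm_pos_iff.2 (hs 0)).trans_le (norm_apply_le_l2Norm _ 0)
  set u : ZMod L → ℂ := fun k => ((m⁻¹ : ℝ) : ℂ) * strideProd θ k with hu
  have hu1 : l2Norm u = 1 := by
    refine (pow_left_inj₀ (norm_nonneg _) zero_le_one two_ne_zero).1 ?_
    have : ∀ k, ‖u k‖ ^ 2 = (m⁻¹) ^ 2 * ‖strideProd θ k‖ ^ 2 := fun k => by
      rw [hu, norm_mul, Complex.norm_real, Real.norm_of_nonneg (inv_nonneg.2 hm0.le), mul_pow]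
    change l2Norm u ^ 2 = 1 ^ 2
    rw [l2Norm_sq]
    simp only [this]
    rw [← Finset.mul_sum, ← l2Norm_sq, ← hm, ← mul_pow, inv_mul_cancel₀ hm0.ne']
  -- The squared norm of the stride-one product is absorbed into the spike strength `κ`.
  have hlim' : ∀ k l, Tendsto (fun N => C N k l) atTop
      (𝓝 (spikedMatrix (2 * lam ^ 2 * m ^ 2) d u k l)) := fun k l => by
    convert hlim k l using 3
    have hmC : (m : ℂ) ≠ 0 := Complex.ofReal_ne_zero.2 hm0.ne'
    simp only [spikedMatrix, hu, star_mul', Complex.star_def, Complex.conj_ofReal]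
    push_cast
    field_simp
  have hκ : 0 < 2 * (lam : ℝ) ^ 2 * m ^ 2 := by
    have : (0 : ℝ) < lam := hlam
    positivity
  have hq := tendsto_aligned_eigenvector hκ hC hv hu1 hlim'
  have hu0 : ∀ k, u k ≠ 0 := fun k =>
    mul_ne_zero (Complex.ofReal_ne_zero.2 (inv_ne_zero hm0.ne')) (hs k)
  -- Nonvanishing of `θ̂` enters here: the limits are nonzero, so phases are eventually defined, and
  -- `phase` is continuous at these limits.
  have hne : ∀ᶠ N in atTop, ∀ k, star (star u ⬝ᵥ v N) * v N k ≠ 0 :=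
    eventually_all.2 fun k => (hq k).eventually_ne (hu0 k)
  refine ⟨fun N => phase (star u ⬝ᵥ v N), ?_, ?_, fun k => ?_⟩
  · filter_upwards [hne] with N hN
    exact norm_phase (star_ne_zero.1 (left_ne_zero_of_mul (hN 0)))
  · filter_upwards [hne] with N hN k
    exact right_ne_zero_of_mul (hN k)
  · have h := (continuousAt_phase (hu0 k)).tendsto.comp (hq k)
    have hpu : phase (u k) = phase (strideProd θ k) := by
      rw [hu, phase_mul, phase_ofReal_pos (inv_pos.2 hm0), one_mul]
    rw [hpu] at h
    refine h.congr fun N => ?_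
    rw [Function.comp_apply, phase_mul, phase_star]

/-- The corrected eigenvectors have the phases of the true stride-one products up to a common
phase `ρ N`, asymptotically an `L`-th root of unity, and the estimates converge along all shifts
that match it. -/
lemma exists_globalPhase {θ : ZMod L → ℂ} (hθ : l2Norm θ = 1) (hpos : ∀ k, fourier θ k ≠ 0)
    {lam : ℝ≥0} (hlam : 0 < lam) {d : ℝ} {c : ℝ} {σ : ℝ≥0} {y : ℕ → ZMod L → ℂ}
    (hp : ∀ k, Tendsto (fun N => powerEst σ N y k) atTop (𝓝 (lam * ‖fourier θ k‖ ^ 2)))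
    (hC : ∀ k l, Tendsto (fun N => covEst σ N y k l) atTop
      (𝓝 (2 * (lam : ℂ) ^ 2 * (strideProd θ k * star (strideProd θ l)) +
        if k = l then (d : ℂ) else 0)))
    {est : ℕ → ZMod L → ℂ}
    (hest : ∀ N, 0 < N → IsFrequencyMarchingEstimate c σ N y (est N)) :
    ∃ ρ Q : ℕ → ℂ, (∀ᶠ N in atTop, ‖ρ N‖ = 1) ∧ Tendsto (fun N => ρ N ^ L) atTop (𝓝 1) ∧
      Tendsto Q atTop (𝓝 (phase (strideProd θ 0))) ∧ (∀ᶠ N in atTop, ‖Q N‖ = 1) ∧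
      (∀ᶠ N in atTop, ∃ x ∈ Set.Ioc 0 (2 * Real.pi / L),
        ρ N * Q N = Complex.exp (((c + x : ℝ) : ℂ) * Complex.I)) ∧
      ∀ r : ℕ → ZMod L, Tendsto (fun N => ZMod.stdAddChar (-(r N)) * star (ρ N)) atTop (𝓝 1) →
        Tendsto (fun N => l2Norm (θ - phase (fourier θ 0) • cyclicShift (r N) (est N)))
          atTop (𝓝 0) := by
  have hex : ∀ N, ∃ (v : ZMod L → ℂ) (j : ℕ), 0 < N → IsLeadingEigenvector (covEst σ N y) v ∧
      IsMinimalPhaseIndex c (phaseCorrection c v) j ∧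
      est N = (dftMatrix L)ᴴ *ᵥ (fun k =>
        frequencyMarching c (rootPhase L j • phaseCorrection c v) k *
          (magnitudeEst σ N y k : ℂ)) := fun N => by
    by_cases hN : 0 < N
    · obtain ⟨v, j, h⟩ := hest N hN
      exact ⟨v, j, fun _ => h⟩
    · exact ⟨0, 0, fun h => absurd h hN⟩
  choose v j hvj using hex
  obtain ⟨τ, hτ, hv0, hQ⟩ := tendsto_phase_eigenvector hpos hlam
    (fun N => isHermitian_covEst σ N y) hC (v := v)
    ((eventually_gt_atTop 0).mono fun N hN => (hvj N hN).1)
  set Q : ℕ → ZMod L → ℂ := fun N k => star (τ N) * phase (v N k) with hQdef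
  -- The combined unimodular factor of both phase corrections; the global phase is `ρ = β τ`.
  set β : ℕ → ℂ := fun N => rootPhase L (j N) * correctionPhase c (v N) with hβ
  have hβ1 : ∀ N, ‖β N‖ = 1 := fun N => by
    rw [hβ, norm_mul, norm_rootPhase, norm_correctionPhase, one_mul]
  have hβ0 : ∀ N, β N ≠ 0 := fun N => norm_ne_zero_iff.1 (by rw [hβ1]; exact one_ne_zero)
  set g : ℕ → ZMod L → ℂ := fun N => rootPhase L (j N) • phaseCorrection c (v N) with hg
  have hgβ : ∀ N k, g N k = β N * v N k := fun N k => by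
    simp only [hg, hβ, phaseCorrection, correctionPhase, Pi.smul_apply, smul_eq_mul, mul_assoc]
  have hgphase : ∀ᶠ N in atTop, ∀ k, phase (g N k) = β N * τ N * Q N k := by
    filter_upwards [hτ] with N hN k
    rw [hgβ, phase_mul, phase_of_norm_eq_one (hβ1 N), hQdef]
    linear_combination (-β N * phase (v N k)) * mul_star_of_norm_eq_one hN
  have hg0 : ∀ᶠ N in atTop, ∀ k, g N k ≠ 0 := hv0.mono fun N hN k => by
    rw [hgβ]
    exact mul_ne_zero (hβ0 N) (hN k)
  have hQn : ∀ᶠ N in atTop, ∀ k, ‖Q N k‖ = 1 := by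
    filter_upwards [hτ, hv0] with N h1 h2 k
    rw [hQdef, norm_mul, norm_star, h1, norm_phase (h2 k), one_mul]
  -- The `L`-th power removes the root of unity and the division by `L` in the correction; the right
  -- side tends to `1` by cyclic telescoping.
  have hpow : ∀ᶠ N in atTop, (β N * τ N) ^ L = ∏ k, star (Q N k) := by
    filter_upwards [hv0] with N h2
    have hτL : τ N ^ L = ∏ _k : ZMod L, τ N := by
      rw [Finset.prod_const, Finset.card_univ, ZMod.card]
    rw [mul_pow, hβ, mul_pow, rootPhase_pow, correctionPhase_pow c h2, one_mul, hτL,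
      ← Finset.prod_mul_distrib]
    refine Finset.prod_congr rfl fun k _ => ?_
    rw [hQdef, star_mul', star_star, mul_comm]
  refine ⟨fun N => β N * τ N, fun N => Q N 0, ?_, ?_, hQ 0, hQn.mono fun N h => h 0, ?_, ?_⟩
  · filter_upwards [hτ] with N hN
    rw [norm_mul, hβ1, hN, one_mul]
  · have h := tendsto_finsetProd Finset.univ fun k _ => (hQ k).star
    rw [prod_star_phase_strideProd hpos] at h
    exact h.congr' (hpow.mono fun N hN => hN.symm)
  · filter_upwards [hgphase, hg0, hv0, eventually_gt_atTop 0] with N h1 h2 h3 hN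
    have hle := (hvj N hN).2.1.argFrom_le (by
      rw [phaseCorrection, Pi.smul_apply]
      exact smul_ne_zero (Complex.exp_ne_zero _) (h3 0))
    have hg' : phaseCorrection c (v N) 0 * rootPhase L (j N) = g N 0 := by
      rw [hg, mul_comm]
      rfl
    rw [hg'] at hle
    refine ⟨argFrom c (g N 0) - c, ⟨?_, by linarith⟩, ?_⟩
    · linarith [(argFrom_mem_Ioc c (g N 0)).1]
    · rw [← h1 0, ← exp_argFrom c (h2 0), add_sub_cancel]
  · intro r hr
    have hα : ‖phase (fourier θ 0)‖ = 1 := norm_phase (hpos 0)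
    -- The shift contributes the `k`-th power of one character value, which merges with the marched
    -- error `star ρ ^ k`.
    have hshift : ∀ᶠ N in atTop, cyclicShift (r N) (est N) = (dftMatrix L)ᴴ *ᵥ fun k =>
        (ZMod.stdAddChar (-(r N)) * star (β N * τ N)) ^ k.val *
          (∏ l ∈ Finset.range k.val, star (Q N (l : ZMod L))) * (magnitudeEst σ N y k : ℂ) := by
      filter_upwards [hgphase, hg0, eventually_gt_atTop 0] with N h1 h2 hN
      rw [(hvj N hN).2.2, cyclicShift_conjTranspose_mulVec]
      congr 1
      ext k
      rw [frequencyMarching_eq_prod c h2]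
      have hchar : (ZMod.stdAddChar (-(k * r N)) : ℂ) = ZMod.stdAddChar (-(r N)) ^ k.val := by
        rw [← AddChar.map_nsmul_eq_pow, nsmul_eq_mul, ZMod.natCast_val, ZMod.cast_id, mul_neg]
      simp only [h1, star_mul' (β N * τ N), Finset.prod_mul_distrib, Finset.prod_const,
        Finset.card_range]
      rw [hchar, mul_pow]
      ring
    refine Tendsto.congr' (hshift.mono fun N hN =>
      congrArg (fun z => l2Norm (θ - phase (fourier θ 0) • z)) hN.symm)
      (tendsto_l2Norm_sub_of_tendsto_fourier hα fun k => ?_)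
    have h1 := (hr.pow k.val).mul
      (tendsto_finsetProd (Finset.range k.val) fun l _ => (hQ (l : ZMod L)).star)
    have h2 := h1.mul ((Complex.continuous_ofReal.tendsto _).comp
      (tendsto_magnitudeEst hθ hlam hp k))
    rw [prod_range_star_phase_strideProd hpos, ZMod.natCast_val, ZMod.cast_id, one_pow, one_mul,
      mul_assoc, phase_mul_norm] at h2
    exact h2

/-- Translates the genericity condition into the one on `L`-th powers. The principal argument may
stand for any branch, since `2π` is a multiple of `2π/L`. -/
lemma exp_mul_phase_pow_ne_one {c : ℝ} {z : ℂ} (hz : z ≠ 0)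
    (h : ∀ n : ℤ, z.arg ≠ c + 2 * Real.pi * n / L) :
    (Complex.exp (-(c : ℂ) * Complex.I) * phase z) ^ L ≠ 1 := by
  intro hone
  have hL : (L : ℂ) ≠ 0 := Nat.cast_ne_zero.2 (NeZero.ne L)
  have hph : phase z = Complex.exp ((z.arg : ℂ) * Complex.I) := by
    rw [phase, div_eq_iff (by simpa using hz), mul_comm]
    exact (Complex.norm_mul_exp_arg_mul_I z).symm
  rw [hph, ← Complex.exp_add, ← Complex.exp_nat_mul, Complex.exp_eq_one_iff] at hone
  obtain ⟨n, hn⟩ := hone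
  apply h n
  have h1 : (L : ℂ) * (z.arg - c) = n * (2 * Real.pi) := by
    apply mul_right_cancel₀ Complex.I_ne_zero
    linear_combination hn
  have h2 : (z.arg : ℂ) = ((c + 2 * Real.pi * n / L : ℝ) : ℂ) := by
    push_cast
    field_simp
    linear_combination h1
  exact_mod_cast h2

end Deterministic

end MRFA

end

theorem mainTheorem1 {L : ℕ} [NeZero L] {Ω : Type*} [MeasurableSpace Ω] (P : Measure Ω)
    [IsProbabilityMeasure P] (θ : ZMod L → ℂ) (lam σ : ℝ≥0)
    (a : ℕ → Ω → ℂ) (s : ℕ → Ω → ZMod L) (η : ℕ → Ω → ZMod L → ℂ) (y : ℕ → Ω → ZMod L → ℂ)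
    (hlam : 0 < lam) (hθ : MRFA.l2Norm θ = 1)
    (hmodel : MRFA.IsRankOneMRFA P θ lam σ a s η y)
    (hpos : ∀ k, 0 < ‖MRFA.fourier θ k‖)
    (c : ℝ) (est : ℕ → Ω → ZMod L → ℂ)
    (hest : ∀ N w, 0 < N →
      MRFA.IsFrequencyMarchingEstimate c σ N (fun i => y i w) (est N w)) :
    ∃ α : ℂ, ‖α‖ = 1 ∧
      (∀ᵐ w ∂P, ∃ r : ℕ → ZMod L,
        Tendsto (fun N => MRFA.l2Norm (θ - α • MRFA.cyclicShift (r N) (est N w)))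
          atTop (𝓝 0)) ∧
      ((∀ n : ℤ, Complex.arg (MRFA.fourier θ 0 * star (MRFA.fourier θ 1))
            ≠ c + 2 * Real.pi * n / L) →
        ∃ r : ZMod L, ∀ᵐ w ∂P,
          Tendsto (fun N => MRFA.l2Norm (θ - α • MRFA.cyclicShift r (est N w)))
            atTop (𝓝 0)) := by
  have hpos' : ∀ k, MRFA.fourier θ k ≠ 0 := fun k => norm_pos_iff.1 (hpos k)
  have hs0 : MRFA.strideProd θ 0 ≠ 0 :=
    mul_ne_zero (hpos' 0) (star_ne_zero.2 (hpos' _))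
  obtain ⟨d, hC⟩ := hmodel.tendsto_covEst
  have hp := ae_all_iff.2 hmodel.tendsto_powerEst
  -- Marching assigns phase `1` to frequency `0`, so `α` restores the phase of `θ̂[0]`.
  refine ⟨MRFA.phase (MRFA.fourier θ 0), MRFA.norm_phase (hpos' 0), ?_, fun harg => ?_⟩
  · filter_upwards [hC, hp] with w hCw hpw
    obtain ⟨ρ, Q, hρ, hpow, -, -, -, hlim⟩ := MRFA.exists_globalPhase hθ hpos' hlam hpw hCw
      (fun N hN => hest N w hN)
    obtain ⟨r, hr⟩ := MRFA.exists_shift_of_tendsto_pow hρ hpow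
    exact ⟨r, hlim r hr⟩
  · have harg' : ∀ n : ℤ, (MRFA.strideProd θ 0).arg ≠ c + 2 * Real.pi * n / L := by
      simpa only [MRFA.strideProd, zero_add] using harg
    obtain ⟨r, hr⟩ := MRFA.exists_fixed_shift c (MRFA.norm_phase hs0)
      (MRFA.exp_mul_phase_pow_ne_one hs0 harg')
    refine ⟨r, ?_⟩
    filter_upwards [hC, hp] with w hCw hpw
    obtain ⟨ρ, Q, -, hpow, hQ, hQn, hx, hlim⟩ := MRFA.exists_globalPhase hθ hpos' hlam hpw hCw
      (fun N hN => hest N w hN)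
    exact hlim (fun _ => r) (hr ρ Q hQ hQn hpow hx)
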